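/- Let $X,Y$ be real reflexive Banach spaces, $Z_1,Z_2$ real Banach spaces, and let $K\subset X$ and $\Lambda\subset Y$ be nonempty, bounded, closed and convex. Assume: - $\phi\colon X\to(-\infty,\infty]$ is proper, convex and lower semicontinuous, and $D(\phi)\cap K\neq\varnothing$, where $D(\phi)=\{x:\phi(x)<\infty\}$; - $J\colon Z_1\to\mathbb R$ and $L\colon Z_2\to\mathbb R$ are locally Lipschitz; - $\gamma_1\colon X\to Z_1$ and $\gamma_2\colon Y\to Z_2$ are linear and compact; - $H\colon Y\to(0,m_H)$, for some $m_H>0$, is continuous for the weak topology of $Y$; - $B\colon X\times Y\to\mathbb R$ is (jointly) convex and lower semicontinuous; - $F\colon X\to X^*$ and $G\colon Y\to Y^*$ are (nonlinear) operators. For a locally Lipschitz $h\colon E\to\mathbb R$ on a Banach space $E$ write $h^0(x;y)=\limsup_{z\to x,\ t\downarrow0}\frac{h(z+ty)-h(z)}{t}$ and $\partial_Ch(x)=\{\xi\in E^*:\langle\xi,y\rangle\le h^0(x;y)\ \forall y\in E\}$. An operator $A\colon E\to E^*$ is hemicontinuous if $\lim_{t\to0_+}\langle A(u+t(v-u)),w\rangle=\langle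 A(u),w\rangle$ for all $u,v,w\in E$. For $\beta\colon E\to\mathbb R$, a set-valued $A\colon E\to2^{E^*}$ is $\beta$-relaxed dissipative if $\langle\zeta_y-\zeta_x,y-x\rangle\le\beta(y-x)$ for all $x,y\in E$, $\zeta_x\in A(x)$, $\zeta_y\in A(y)$ (a single-valued operator is regarded as set-valued). Consider the conditions on $F$: - $(H_F^1)$ for every $v\in X$, $\liminf_{n\to\infty}\langle F(u_n),v-u_n\rangle\ge\langle F(u),v-u\rangle$ whenever $u_n\rightharpoonup u$ in $X$; - $(H_F^2)$ $F$ is hemicontinuous and there is a concave $\beta_F\colon X\to\mathbb R$ with $\beta_F(0)\le0$ such that $F$ is $\beta_F$-relaxed dissipative; - $(H_F^3)$ $F$ is hemicontinuous and there is a concave $\beta_T\colon X\to\mathbb R$ with $\beta_T(0)\le0$ such that $T(u):=F(u)-\gamma_1^*\partial_CJ(\gamma_1(u))$ is $\beta_T$-relaxed dissipative; and on $G$: - $(H_G^1)$ for every $\mu\in Y$, $\liminf_{n\to\infty}\langle G(\sigma_n),\mu-\sigma_n\rangle\ge\langle G(\sigma),\mu-\sigma\rangle$ whenever $\sigma_n\rightharpoonup\sigma$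 in $Y$; - $(H_G^2)$ $G$ is hemicontinuous and there is a concave $\beta_G\colon Y\to\mathbb R$ with $\beta_G(0)\le0$ such that $G$ is $\beta_G$-relaxed dissipative; - $(H_G^3)$ $G$ is hemicontinuous and there is a concave $\beta_S\colon Y\to\mathbb R$ with $\beta_S(0)\le0$ such that $S(\sigma):=G(\sigma)-H(\sigma)\gamma_2^*\partial_CL(\gamma_2(\sigma))$ is $\beta_S$-relaxed dissipative. If $(H_F^j)$ and $(H_G^k)$ hold for some $j,k\in\{1,2,3\}$, then there exists $(u,\sigma)\in(K\cap D(\phi))\times\Lambda$ such that $$B(v,\sigma)-B(u,\sigma)+\phi(v)-\phi(u)+J^0(\gamma_1(u);\gamma_1(v-u))\ge\langle F(u),v-u\rangle\quad\text{for all }v\in K,$$ $$B(u,\mu)-B(u,\sigma)+H(\sigma)L^0(\gamma_2(\sigma);\gamma_2(\mu-\sigma))\ge\langle G(\sigma),\mu-\sigma\rangle\quad\text{for all }\mu\in\Lambda.$$ -/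

import Mathlib

open Filter Topology

namespace VarHemivar

noncomputable section

/-- A real normed space is reflexive if the canonical embedding into its bidual is onto. -/
def IsReflexive (E : Type*) [NormedAddCommGroup E] [NormedSpace ℝ E] : Prop :=
  Function.Surjective (NormedSpace.inclusionInDoubleDual ℝ E)

section OneSpace

variable {E : Type*} [NormedAddCommGroup E] [NormedSpace ℝ E]

/-- Weak convergence of sequences, `xₙ ⇀ x`. -/
def WeaklyTendsto (x : ℕ → E) (x₀ : E) : Prop :=
  Tendsto (fun n => toWeakSpace ℝ E (x n)) atTop (𝓝 (toWeakSpace ℝ E x₀))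

/-- Continuity of a real function with respect to the weak topology of `E`. -/
def WeaklyContinuous (h : E → ℝ) : Prop :=
  Continuous fun x : WeakSpace ℝ E => h ((toWeakSpace ℝ E).symm x)

/-- The effective domain `D(φ) = {x | φ x < +∞}`. -/
def effDomain (φ : E → EReal) : Set E := {x | φ x < ⊤}

/-- Convexity of a functional with values in `(-∞, +∞]`. -/
def IsConvex (φ : E → EReal) : Prop :=
  ∀ x y : E, ∀ t : ℝ, 0 ≤ t → t ≤ 1 →
    φ (t • x + (1 - t) • y) ≤ (t : EReal) * φ x + ((1 - t : ℝ) : EReal) * φ y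

/-- Clarke's generalized derivative `h⁰(x; y)`, the upper limit of `(h (z + t y) - h z) / t`
as `z → x` and `t ↓ 0`. -/
def clarkeDeriv (h : E → ℝ) (x y : E) : ℝ :=
  limsup (fun p : E × ℝ => (h (p.1 + p.2 • y) - h p.1) / p.2) (𝓝 x ×ˢ 𝓝[>] (0 : ℝ))

/-- The Clarke subdifferential `∂_C h(x)`. -/
def clarkeSubdiff (h : E → ℝ) (x : E) : Set (StrongDual ℝ E) :=
  {ξ | ∀ y : E, ξ y ≤ clarkeDeriv h x y}

/-- A set-valued mapping `A : E → 2^{E*}` is `β`-relaxed dissipative. -/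
def RelaxedDissipative (β : E → ℝ) (A : E → Set (StrongDual ℝ E)) : Prop :=
  ∀ x y : E, ∀ ζx ∈ A x, ∀ ζy ∈ A y, (ζy - ζx) (y - x) ≤ β (y - x)

/-- Hemicontinuity of a single-valued operator `A : E → E*`. -/
def Hemicontinuous (A : E → StrongDual ℝ E) : Prop :=
  ∀ u v w : E, Tendsto (fun t : ℝ => A (u + t • (v - u)) w) (𝓝[>] 0) (𝓝 (A u w))

/-- Condition (H¹): `u ↦ ⟨A u, v - u⟩` is weakly (sequentially) lower semicontinuous for every `v`.
The lower limit is taken in the extended reals. -/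
def CondH1 (A : E → StrongDual ℝ E) : Prop :=
  ∀ (v : E) (x : ℕ → E) (u : E), WeaklyTendsto x u →
    ((A u (v - u) : ℝ) : EReal) ≤
      liminf (fun n => ((A (x n) (v - x n) : ℝ) : EReal)) atTop

/-- `A` is `β`-relaxed dissipative for some concave `β : E → ℝ` with `β 0 ≤ 0`. -/
def ConcavelyDissipative (A : E → Set (StrongDual ℝ E)) : Prop :=
  ∃ β : E → ℝ, ConcaveOn ℝ Set.univ β ∧ β 0 ≤ 0 ∧ RelaxedDissipative β A

/-- Condition (H²). -/
def CondH2 (A : E → StrongDual ℝ E) : Prop :=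
  Hemicontinuous A ∧ ConcavelyDissipative fun x => {A x}

/-- The set-valued operator `x ↦ A x - c(x) γ* ∂_C h(γ x)`. -/
def shiftedOp {Z : Type*} [NormedAddCommGroup Z] [NormedSpace ℝ Z]
    (A : E → StrongDual ℝ E) (c : E → ℝ) (γ : E →L[ℝ] Z) (h : Z → ℝ) (x : E) :
    Set (StrongDual ℝ E) :=
  {ζ | ∃ ξ ∈ clarkeSubdiff h (γ x), ζ = A x - c x • (ξ.comp γ)}

/-- Condition (H³): `A` is hemicontinuous and `x ↦ A x - c(x) γ* ∂_C h(γ x)` is relaxed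
dissipative as in (H²). -/
def CondH3 {Z : Type*} [NormedAddCommGroup Z] [NormedSpace ℝ Z]
    (A : E → StrongDual ℝ E) (c : E → ℝ) (γ : E →L[ℝ] Z) (h : Z → ℝ) : Prop :=
  Hemicontinuous A ∧ ConcavelyDissipative (shiftedOp A c γ h)

end OneSpace

/-- `(u, σ)` solves the coupled system: `(u, σ) ∈ (K ∩ D(φ)) × Λ` and both inequalities hold
for all `v ∈ K` and all `μ ∈ Λ`. The first one is an inequality in `(-∞, +∞]`. -/
def IsSolution {X Y Z₁ Z₂ : Type*}
    [NormedAddCommGroup X] [NormedSpace ℝ X] [NormedAddCommGroup Y] [NormedSpace ℝ Y]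
    [NormedAddCommGroup Z₁] [NormedSpace ℝ Z₁] [NormedAddCommGroup Z₂] [NormedSpace ℝ Z₂]
    (K : Set X) (Λ : Set Y) (B : X × Y → ℝ) (φ : X → EReal)
    (γ₁ : X →L[ℝ] Z₁) (γ₂ : Y →L[ℝ] Z₂) (J : Z₁ → ℝ) (L : Z₂ → ℝ) (H : Y → ℝ)
    (F : X → StrongDual ℝ X) (G : Y → StrongDual ℝ Y) (u : X) (σ : Y) : Prop :=
  u ∈ K ∩ effDomain φ ∧ σ ∈ Λ ∧
  (∀ v ∈ K, ((F u (v - u) : ℝ) : EReal) ≤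
    ((B (v, σ) - B (u, σ) : ℝ) : EReal) + (φ v - φ u)
      + ((clarkeDeriv J (γ₁ u) (γ₁ (v - u)) : ℝ) : EReal)) ∧
  (∀ μ ∈ Λ, G σ (μ - σ) ≤
    B (u, μ) - B (u, σ) + H σ * clarkeDeriv L (γ₂ σ) (γ₂ (μ - σ)))

end

end VarHemivar

/-! Add the two inequalities. On the reflexive space `X × Y` put ψ(u,σ) = φ(u) + B(u,σ) and let f be
the sum of the two `hemiForm`s. A point (u,σ) with f((u,σ),(v,μ)) ≤ ψ(v,μ) - ψ(u,σ) for all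
admissible (v,μ) solves the system: μ = σ gives the first inequality and v = u the second, because
each form vanishes on the diagonal.

The three alternatives for each operator enter only through `IsMintyPair`: a minorant g of f, weakly
sequentially lower semicontinuous in its first variable, that recovers f along segments. Under (H¹)
take g = f. Under (H²), (H³) the operator is evaluated at the test point; g ≤ f holds since a
concave modulus β with β(0) ≤ 0 is forced to be nonpositive (`RelaxedDissipative.nonpos`). Minty
pairs add up on products, so all combinations are handled at once.

`exists_equilibrium` solves ψ(u) + g(u,v) ≤ ψ(v) for all v. Finitely many of these conditions are
compatible by the KKM lemma, which rests on Brouwer's theorem, proved here by the volume argument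
for C¹ retractions. Reflexivity gives weak limits of bounded ultrafilters; as semicontinuity is only
sequential, Whitley's construction replaces them by sequences. Testing on short segments then turns
g back into f. -/

namespace VarHemivar

/-! ### Brouwer's fixed point theorem in Euclidean spaces -/

section Brouwer

open MeasureTheory Metric Set

variable {E : Type*} [NormedAddCommGroup E] [InnerProductSpace ℝ E] [FiniteDimensional ℝ E]

/-- Lagrange interpolation of `t ↦ det (1 + t A)`: its value at `1` is a fixed combination of its
values at any `dim E + 1` distinct nodes, with weights summing to `1`. -/
theorem exists_weights_det_one_add_smul (v : ℕ → ℝ) (hv : Function.Injective v) :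
    ∃ w : ℕ → ℝ, (∑ i ∈ Finset.range (Module.finrank ℝ E + 1), w i = 1) ∧
      ∀ A : E →L[ℝ] E, (1 + A).det =
        ∑ i ∈ Finset.range (Module.finrank ℝ E + 1), w i * (1 + v i • A).det := by
  set n := Module.finrank ℝ E
  set s := Finset.range (n + 1)
  have hinj : Set.InjOn v s := hv.injOn
  refine ⟨fun i => (Lagrange.basis s v i).eval 1, ?_, fun A => ?_⟩
  · have := congrArg (Polynomial.eval 1) (Lagrange.sum_basis hinj (by simp [s]))
    simpa [Polynomial.eval_finsetSum] using this
  · let b := Module.finBasis ℝ E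
    let M := LinearMap.toMatrix b b (A : E →ₗ[ℝ] E)
    let p : Polynomial ℝ :=
      ((Polynomial.X : Polynomial ℝ) • M.map Polynomial.C +
        (1 : Matrix (Fin n) (Fin n) ℝ).map Polynomial.C).det
    have hp : ∀ t, p.eval t = (1 + t • A).det := by
      intro t
      have h1 : (1 + t • A).det = (1 + t • M).det := by
        rw [ContinuousLinearMap.det, ← LinearMap.det_toMatrix b]
        congr 1
        simp [M, LinearMap.toMatrix_one]
      rw [h1]
      simp only [p]
      rw [← Polynomial.coe_evalRingHom, RingHom.map_det]
      congr 1
      ext i j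
      simp [Matrix.one_apply, add_comm]
      split_ifs <;> simp [mul_comm]
    have hdeg : p.degree < s.card := by
      have := Polynomial.natDegree_det_X_add_C_le M 1
      refine lt_of_le_of_lt Polynomial.degree_le_natDegree ?_
      simp only [s, Finset.card_range]
      simp only [Fintype.card_fin] at this
      exact_mod_cast Nat.lt_succ_of_le this
    have := congrArg (Polynomial.eval 1) (Lagrange.eq_interpolate hinj hdeg)
    rw [hp, one_smul, Lagrange.interpolate_apply] at this
    rw [this]
    simp [Polynomial.eval_finsetSum, hp, mul_comm]

/-- A small perturbation of the identity which is the identity on the unit sphere and does not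
leave the unit ball maps the open unit ball onto itself. -/
theorem image_ball_of_approximatesLinearOn [Nontrivial E] {h : E → E} {c : NNReal} (hc : c < 1)
    (hh : ApproximatesLinearOn h (ContinuousLinearMap.id ℝ E) (closedBall 0 1) c)
    (hs : ∀ x ∈ sphere (0 : E) 1, h x = x) (hb : ∀ x ∈ ball (0 : E) 1, h x ∈ ball (0 : E) 1) :
    InjOn h (ball 0 1) ∧ h '' ball 0 1 = ball 0 1 := by
  have hh' : ApproximatesLinearOn h ((ContinuousLinearEquiv.refl ℝ E : E ≃L[ℝ] E) : E →L[ℝ] E)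
      (ball 0 1) c := hh.mono_set ball_subset_closedBall
  have hcN : c < ‖((ContinuousLinearEquiv.refl ℝ E).symm : E →L[ℝ] E)‖₊⁻¹ := by
    have : ‖((ContinuousLinearEquiv.refl ℝ E).symm : E →L[ℝ] E)‖₊ = 1 := by
      ext; simp
    rwa [this, inv_one]
  have hopen : IsOpen (h '' ball 0 1) :=
    hh'.open_image (ContinuousLinearEquiv.refl ℝ E).toNonlinearRightInverse isOpen_ball (Or.inr hcN)
  refine ⟨hh'.injOn (Or.inr hcN), Subset.antisymm (image_subset_iff.2 fun x hx => hb x hx) ?_⟩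
  -- The image is open, and relatively closed in the connected ball: a limit of image points is the
  -- image of a point of the closed ball, and a point of the sphere, being fixed, cannot land in the
  -- open ball.
  have hpc : IsPreconnected (ball (0 : E) 1) := (convex_ball 0 1).isPreconnected
  refine hpc.subset_of_closure_inter_subset hopen
    ⟨h 0, hb 0 (by simp), mem_image_of_mem _ (by simp)⟩ ?_
  rintro y ⟨hy, hyb⟩
  have hcomp : IsCompact (h '' closedBall 0 1) :=
    (isCompact_closedBall 0 1).image_of_continuousOn hh.continuousOn
  have : y ∈ h '' closedBall 0 1 :=
    closure_minimal (image_mono ball_subset_closedBall) hcomp.isClosed hy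
  obtain ⟨x, hx, rfl⟩ := this
  rcases (mem_closedBall.1 hx).lt_or_eq with hlt | heq
  · exact mem_image_of_mem _ hlt
  · rw [hs x heq] at hyb
    exact absurd hyb (by simp [mem_ball, heq])

/-- There is no `C¹` map into the unit sphere that is the identity on the sphere. -/
theorem no_contDiff_retraction {r : E → E} (hr : ContDiff ℝ 1 r) (h1 : ∀ x, ‖r x‖ = 1)
    (hid : ∀ x, ‖x‖ = 1 → r x = x) : False := by
  have : Nontrivial E := ⟨r 0, 0, fun h => by simpa [h] using h1 0⟩
  borelize E
  let μ : Measure E := Measure.addHaar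
  -- The homotopy x + t q(x) = (1 - t) x + t r(x) joins the identity to the retraction.
  let q : E → E := fun x => r x - x
  have hq : ContDiff ℝ 1 q := hr.sub contDiff_id
  have hq' : Continuous (fderiv ℝ q) := hq.continuous_fderiv one_ne_zero
  obtain ⟨C, hC⟩ := (isCompact_closedBall (0 : E) 1).exists_bound_of_continuousOn hq'.continuousOn
  let D : NNReal := ⟨max C 1, le_trans zero_le_one (le_max_right _ _)⟩
  have hD : ∀ x ∈ closedBall (0 : E) 1, ‖fderiv ℝ q x‖₊ ≤ D := fun x hx =>
    (hC x hx).trans (le_max_left _ _)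
  have hD1 : (1 : ℝ) ≤ D := le_max_right _ _
  have hlip : LipschitzOnWith D q (closedBall 0 1) :=
    Convex.lipschitzOnWith_of_nnnorm_fderiv_le (𝕜 := ℝ)
      (fun x _ => hq.differentiable one_ne_zero x) hD (convex_closedBall 0 1)
  obtain ⟨δ, hδ, hdet⟩ : ∃ δ > 0, ∀ A : E →L[ℝ] E, ‖A‖ < δ → 0 < (1 + A).det := by
    have hcont : Continuous fun A : E →L[ℝ] E => (1 + A).det :=
      ContinuousLinearMap.continuous_det.comp (continuous_const.add continuous_id)
    have : ∀ᶠ A in 𝓝 (0 : E →L[ℝ] E), 0 < (1 + A).det := by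
      refine hcont.continuousAt.eventually (lt_mem_nhds ?_)
      simp [ContinuousLinearMap.det]
    obtain ⟨δ, hδ, h⟩ := Metric.eventually_nhds_iff.1 this
    exact ⟨δ, hδ, fun A hA => h (by simpa using hA)⟩
  have hintegrable : ∀ t : ℝ, IntegrableOn (fun x => (1 + t • fderiv ℝ q x).det) (ball 0 1) μ := by
    intro t
    have : Continuous fun x => (1 + t • fderiv ℝ q x).det :=
      ContinuousLinearMap.continuous_det.comp (continuous_const.add (hq'.const_smul t))
    exact (this.continuousOn.integrableOn_compact (isCompact_closedBall 0 1)).mono_set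
      ball_subset_closedBall
  -- volume is preserved for small `t`
  have key : ∀ t : ℝ, 0 < t → t * D < min 1 δ →
      ∫ x in ball 0 1, (1 + t • fderiv ℝ q x).det ∂μ = μ.real (ball 0 1) := by
    intro t ht htD
    have ht1 : t < 1 := by
      have := lt_of_lt_of_le htD (min_le_left _ _)
      nlinarith
    let h : E → E := fun x => x + t • q x
    let c : NNReal := ⟨t, ht.le⟩ * D
    have hc : c < 1 := by
      rw [← NNReal.coe_lt_coe]; exact lt_of_lt_of_le htD (min_le_left _ _)
    have happ : ApproximatesLinearOn h (ContinuousLinearMap.id ℝ E) (closedBall 0 1) c := by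
      intro x hx y hy
      have h2 : h x - h y - (ContinuousLinearMap.id ℝ E) (x - y) = t • (q x - q y) := by
        simp only [h, ContinuousLinearMap.id_apply, smul_sub]; abel
      rw [h2, norm_smul, Real.norm_of_nonneg ht.le]
      have := hlip.norm_sub_le hx hy
      calc t * ‖q x - q y‖ ≤ t * (D * ‖x - y‖) := by gcongr
        _ = c * ‖x - y‖ := by rw [← mul_assoc]; rfl
    have hmaps : ∀ x ∈ ball (0 : E) 1, h x ∈ ball (0 : E) 1 := by
      intro x hx
      rw [mem_ball_zero_iff] at hx ⊢
      have h2 : h x = (1 - t) • x + t • r x := by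
        simp only [h, q, smul_sub, sub_smul, one_smul]; abel
      rw [h2]
      calc ‖(1 - t) • x + t • r x‖ ≤ ‖(1 - t) • x‖ + ‖t • r x‖ := norm_add_le _ _
        _ = (1 - t) * ‖x‖ + t := by
          rw [norm_smul, norm_smul, h1, Real.norm_of_nonneg ht.le,
            Real.norm_of_nonneg (by linarith), mul_one]
        _ < 1 := by nlinarith
    obtain ⟨hinj, himg⟩ := image_ball_of_approximatesLinearOn hc happ
      (fun x hx => by simp [h, q, hid x (by simpa using hx)]) hmaps
    have hder : ∀ x ∈ ball (0 : E) 1,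
        HasFDerivWithinAt h (1 + t • fderiv ℝ q x) (ball 0 1) x := fun x _ =>
      ((hasFDerivAt_id x).add
        ((hq.differentiable one_ne_zero x).hasFDerivAt.const_smul t)).hasFDerivWithinAt
    have hcv := integral_image_eq_integral_abs_det_fderiv_smul μ measurableSet_ball hder hinj
      (fun _ => (1 : ℝ))
    rw [himg] at hcv
    simp only [smul_eq_mul, mul_one, integral_const, MeasurableSet.univ, measureReal_restrict_apply,
      univ_inter] at hcv
    rw [hcv]
    refine setIntegral_congr_fun measurableSet_ball fun x hx => ?_
    refine (abs_of_pos (hdet _ ?_)).symm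
    rw [norm_smul, Real.norm_of_nonneg ht.le]
    calc t * ‖fderiv ℝ q x‖ ≤ t * D := by
          gcongr; exact hD x (ball_subset_closedBall hx)
      _ < δ := lt_of_lt_of_le htD (min_le_right _ _)
  -- the derivative of `r` is singular
  have hsing : ∀ x, (1 + fderiv ℝ q x).det = 0 := by
    intro x
    have hrx : HasFDerivAt r (1 + fderiv ℝ q x) x := by
      have : HasFDerivAt (fun y => y + q y) (1 + fderiv ℝ q x) x :=
        (hasFDerivAt_id x).add (hq.differentiable one_ne_zero x).hasFDerivAt
      simpa [q] using this
    -- Differentiating ‖r‖² = 1 shows that r x is orthogonal to the range of the derivative;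
    -- invertibility would put r x itself in that range.
    by_contra hne
    have hunit : IsUnit (LinearMap.det ((1 + fderiv ℝ q x : E →L[ℝ] E) : E →ₗ[ℝ] E)) :=
      isUnit_iff_ne_zero.2 hne
    obtain ⟨v, hv⟩ := (LinearMap.equivOfIsUnitDet hunit).surjective (r x)
    have hv' : (1 + fderiv ℝ q x) v = r x := by
      rw [← hv, LinearMap.equivOfIsUnitDet_apply]; rfl
    have hn : HasFDerivAt (fun y => inner ℝ (r y) (r y)) _ x := hrx.inner ℝ hrx
    have hcst : (fun y => inner ℝ (r y) (r y)) = fun _ => (1 : ℝ) := by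
      ext y; rw [real_inner_self_eq_norm_sq, h1]; norm_num
    rw [hcst] at hn
    have h0 := congrArg (fun f : E →L[ℝ] ℝ => f v) (hn.unique (hasFDerivAt_const _ _))
    simp only [ContinuousLinearMap.comp_apply, ContinuousLinearMap.prod_apply,
      fderivInnerCLM_apply, hv', zero_apply, real_inner_self_eq_norm_sq,
      h1] at h0
    norm_num at h0
  -- The nodes η/(i + 1) are distinct and satisfy v i * D ≤ min 1 δ / 2, so `key` applies at each.
  -- Interpolating to t = 1 makes the integral of a zero determinant equal to the volume of the
  -- ball.
  let η : ℝ := min 1 δ / (2 * D)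
  have hη : 0 < η := by positivity
  let v : ℕ → ℝ := fun i => η / (i + 1)
  have hv : Function.Injective v := by
    intro i j hij
    simp only [v] at hij
    have hi : (0 : ℝ) < i + 1 := by positivity
    have hj : (0 : ℝ) < j + 1 := by positivity
    rw [div_eq_div_iff hi.ne' hj.ne'] at hij
    have := mul_left_cancel₀ hη.ne' hij
    exact_mod_cast (add_right_cancel this).symm
  have hvpos : ∀ i, 0 < v i := fun i => by positivity
  have hvD : ∀ i, v i * D < min 1 δ := by
    intro i
    have h2 : v i ≤ η := div_le_self hη.le (by linarith [(Nat.cast_nonneg i : (0 : ℝ) ≤ i)])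
    have h3 : η * D = min 1 δ / 2 := by simp only [η]; field_simp
    have h4 : 0 < min 1 δ := by positivity
    nlinarith
  obtain ⟨w, hw1, hw⟩ := exists_weights_det_one_add_smul (E := E) v hv
  have h0 : ∫ x in ball 0 1, (1 + fderiv ℝ q x).det ∂μ = 0 := by simp [hsing]
  have h2 : ∫ x in ball 0 1, (1 + fderiv ℝ q x).det ∂μ = μ.real (ball 0 1) := by
    rw [integral_congr_ae (Eventually.of_forall fun x => hw (fderiv ℝ q x))]
    rw [integral_finsetSum _ fun i _ => (hintegrable (v i)).const_mul _]
    simp_rw [integral_const_mul, key _ (hvpos _) (hvD _), ← Finset.sum_mul, hw1, one_mul]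
  have h3 : 0 < μ.real (ball (0 : E) 1) :=
    ENNReal.toReal_pos (measure_ball_pos μ 0 one_pos).ne' measure_ball_lt_top.ne
  linarith

/-- A continuous self-map with support in the open unit ball has a fixed point. -/
theorem exists_fixedPoint_of_support_subset_ball {g : E → E} (hg : Continuous g)
    (hsupp : Function.support g ⊆ ball 0 1) : ∃ x, g x = x := by
  by_contra! hne
  -- A C¹ approximation closer to g than x is to g x has no fixed point either; its support stays in
  -- the ball, so normalising x - p x fixes the sphere.
  obtain ⟨p, hp, hpg, hps⟩ := hg.exists_contDiff_approx (ε := fun x => ‖x - g x‖) 1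
    (by fun_prop) (fun x => norm_pos_iff.2 (sub_ne_zero.2 (hne x).symm))
  have hF : ∀ x, x - p x ≠ 0 := by
    intro x h0
    have := hpg x
    rw [← sub_eq_zero.1 h0, dist_eq_norm] at this
    exact lt_irrefl _ this
  have hFd : ContDiff ℝ 1 fun x => x - p x := contDiff_id.sub hp
  refine no_contDiff_retraction (r := fun x => ‖x - p x‖⁻¹ • (x - p x))
    (((hFd.norm ℝ hF).inv fun x => norm_ne_zero_iff.2 (hF x)).smul hFd) (fun x => ?_) ?_
  · rw [norm_smul, norm_inv, norm_norm, inv_mul_cancel₀ (norm_ne_zero_iff.2 (hF x))]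
  · intro x hx
    have : p x = 0 := by
      by_contra h
      have := hsupp (hps h)
      simp [hx] at this
    simp [this, hx]

/-- **Brouwer's fixed point theorem** for continuous maps with bounded range. -/
theorem exists_fixedPoint_of_bounded {f : E → E} (hf : Continuous f) {R : ℝ}
    (hR : ∀ x, ‖f x‖ ≤ R) : ∃ x, f x = x := by
  have hR0 : 0 ≤ R := (norm_nonneg _).trans (hR 0)
  set S := R + 1
  have hS : 0 < S := by positivity
  -- Cutoff equal to 1 for ‖y‖ ≤ R / S. A fixed point of the rescaled, cut-off map has norm at most
  -- R / S, where the cutoff is inactive.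
  let χ : E → ℝ := fun y => max 0 (min 1 (S * (1 - ‖y‖)))
  obtain ⟨y, hy⟩ := exists_fixedPoint_of_support_subset_ball
    (g := fun y => χ y • S⁻¹ • f (S • y)) (by fun_prop) (by
      intro y hy
      by_contra hyb
      have h1 : 1 ≤ ‖y‖ := by simpa using hyb
      have : χ y = 0 := by
        have : S * (1 - ‖y‖) ≤ 0 := mul_nonpos_of_nonneg_of_nonpos hS.le (by linarith)
        exact max_eq_left ((min_le_right _ _).trans this)
      simp [this] at hy)
  have hχ0 : 0 ≤ χ y := le_max_left _ _
  have hχ1 : χ y ≤ 1 := max_le zero_le_one (min_le_left _ _)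
  have hny : S * ‖y‖ ≤ R := by
    have : ‖y‖ = χ y * (S⁻¹ * ‖f (S • y)‖) := by
      conv_lhs => rw [← hy]
      rw [norm_smul, norm_smul, Real.norm_of_nonneg hχ0, norm_inv, Real.norm_of_nonneg hS.le]
    rw [this]
    have h2 := hR (S • y)
    have h3 : S * (χ y * (S⁻¹ * ‖f (S • y)‖)) = χ y * ‖f (S • y)‖ := by field_simp
    rw [h3]
    nlinarith [norm_nonneg (f (S • y))]
  have hχ : χ y = 1 := by
    have : 1 ≤ S * (1 - ‖y‖) := by simp only [S] at *; nlinarith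
    simp [χ, min_eq_left this]
  simp only [hχ, one_smul] at hy
  refine ⟨S • y, ?_⟩
  conv_rhs => rw [← hy, smul_inv_smul₀ hS.ne']

end Brouwer

/-! ### The KKM lemma on the standard simplex -/

section KKM

variable {ι : Type*} [Fintype ι]

/-- A continuous retraction of `ι → ℝ` onto the standard simplex. -/
noncomputable def simplexRetraction (x : ι → ℝ) : ι → ℝ := fun i =>
  -- After taking positive parts, a deficit of mass is spread evenly over the coordinates, while an
  -- excess is removed by normalisation.
  (max (x i) 0 + max (1 - ∑ j, max (x j) 0) 0 / Fintype.card ι) / max 1 (∑ j, max (x j) 0)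

theorem continuous_simplexRetraction : Continuous (simplexRetraction (ι := ι)) := by
  refine continuous_pi fun i => Continuous.div (by fun_prop) (by fun_prop) fun x => ?_
  positivity

theorem simplexRetraction_mem [Nonempty ι] (x : ι → ℝ) : simplexRetraction x ∈ stdSimplex ℝ ι := by
  refine ⟨fun i => by unfold simplexRetraction; positivity, ?_⟩
  unfold simplexRetraction
  set s := ∑ j, max (x j) 0
  rw [← Finset.sum_div, Finset.sum_add_distrib, Finset.sum_const, Finset.card_univ, nsmul_eq_mul,
    mul_div_cancel₀ _ (by simp), div_eq_one_iff_eq (by positivity)]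
  rcases le_total s 1 with h | h
  · rw [max_eq_left (by linarith), max_eq_left h]; ring
  · rw [max_eq_right (by linarith), max_eq_right h]; ring

theorem simplexRetraction_eq_self {x : ι → ℝ} (hx : x ∈ stdSimplex ℝ ι) :
    simplexRetraction x = x := by
  have h : ∀ i, max (x i) 0 = x i := fun i => max_eq_left (hx.1 i)
  ext i
  simp [simplexRetraction, h, hx.2]

/-- **Brouwer's fixed point theorem** on the standard simplex. -/
theorem exists_fixedPoint_stdSimplex [Nonempty ι] {f : (ι → ℝ) → ι → ℝ}
    (hf : ContinuousOn f (stdSimplex ℝ ι)) (hmaps : Set.MapsTo f (stdSimplex ℝ ι) (stdSimplex ℝ ι)) :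
    ∃ x ∈ stdSimplex ℝ ι, f x = x := by
  have hfp : Continuous fun x => f (simplexRetraction x) :=
    hf.comp_continuous continuous_simplexRetraction simplexRetraction_mem
  obtain ⟨R, hR⟩ := (isCompact_stdSimplex ℝ ι).exists_bound_of_continuousOn
    (f := fun x : ι → ℝ => WithLp.toLp 2 x) (PiLp.continuous_toLp 2 _).continuousOn
  obtain ⟨y, hy⟩ := exists_fixedPoint_of_bounded
    (f := fun y : EuclideanSpace ℝ ι => WithLp.toLp 2 (f (simplexRetraction (WithLp.ofLp y))))
    ((PiLp.continuous_toLp 2 _).comp (hfp.comp (PiLp.continuous_ofLp 2 _)))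
    (fun y => hR _ (hmaps (simplexRetraction_mem _)))
  have hy' : f (simplexRetraction (WithLp.ofLp y)) = WithLp.ofLp y := by
    conv_rhs => rw [← hy]
  have hmem : WithLp.ofLp y ∈ stdSimplex ℝ ι := by
    rw [← hy']; exact hmaps (simplexRetraction_mem _)
  exact ⟨_, hmem, by rwa [simplexRetraction_eq_self hmem] at hy'⟩

/-- The **Knaster–Kuratowski–Mazurkiewicz lemma**. -/
theorem exists_mem_stdSimplex_forall_mem [Nonempty ι] {C : ι → Set (ι → ℝ)} (hC : ∀ i, IsClosed (C i))
    (hcov : ∀ x ∈ stdSimplex ℝ ι, ∃ i, 0 < x i ∧ x ∈ C i) :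
    ∃ x ∈ stdSimplex ℝ ι, ∀ i, x ∈ C i := by
  classical
  have hne : ∀ i, (C i).Nonempty := by
    intro i
    obtain ⟨j, hj, hjC⟩ := hcov _ (single_mem_stdSimplex ℝ i)
    have : j = i := by
      by_contra h
      simp [h] at hj
    exact ⟨_, this ▸ hjC⟩
  by_contra! hcon
  let d : ι → (ι → ℝ) → ℝ := fun i x => Metric.infDist x (C i)
  have hd0 : ∀ i x, 0 ≤ d i x := fun i x => Metric.infDist_nonneg
  have hdpos : ∀ i x, 0 < d i x ↔ x ∉ C i := fun i x =>
    ((hC i).notMem_iff_infDist_pos (hne i)).symm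
  have hs : ∀ x ∈ stdSimplex ℝ ι, 0 < ∑ i, d i x := by
    intro x hx
    obtain ⟨i, hi⟩ := hcon x hx
    exact Finset.sum_pos' (fun i _ => hd0 i x) ⟨i, Finset.mem_univ _, (hdpos i x).2 hi⟩
  -- Brouwer is applied to the normalised distances. At a fixed point, some i has x i > 0 and x ∈ C
  -- i, yet its normalised distance vanishes.
  obtain ⟨x, hx, hfx⟩ := exists_fixedPoint_stdSimplex
    (f := fun x i => d i x / ∑ j, d j x)
    (continuousOn_pi.2 fun i => ContinuousOn.div (Metric.continuous_infDist_pt _).continuousOn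
      (continuous_finsetSum _ fun j _ => Metric.continuous_infDist_pt _).continuousOn
      fun x hx => (hs x hx).ne')
    (fun x hx => ⟨fun i => div_nonneg (hd0 i x) (hs x hx).le, by
      rw [← Finset.sum_div, div_self (hs x hx).ne']⟩)
  obtain ⟨i, hi, hiC⟩ := hcov x hx
  have h0 : d i x = 0 := Metric.infDist_zero_of_mem hiC
  have := congrFun hfx i
  simp only [h0, zero_div] at this
  exact hi.ne this

end KKM

/-! ### Weak convergence, reflexivity and Whitley's construction -/

section Weak

variable {E : Type*} [NormedAddCommGroup E] [NormedSpace ℝ E]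

theorem weaklyTendsto_iff {x : ℕ → E} {x₀ : E} :
    WeaklyTendsto x x₀ ↔ ∀ f : StrongDual ℝ E, Tendsto (fun n => f (x n)) atTop (𝓝 (f x₀)) :=
  WeakBilin.tendsto_iff_forall_eval_tendsto _ (by
    intro a b h
    exact SeparatingDual.eq_iff_forall_dual_eq (R := ℝ) |>.2 fun f => congrArg (fun g => g f) h)

theorem WeaklyTendsto.comp_clm {F : Type*} [NormedAddCommGroup F] [NormedSpace ℝ F]
    {x : ℕ → E} {x₀ : E} (h : WeaklyTendsto x x₀) (T : E →L[ℝ] F) :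
    WeaklyTendsto (fun n => T (x n)) (T x₀) :=
  weaklyTendsto_iff.2 fun f => weaklyTendsto_iff.1 h (f.comp T)

theorem WeaklyContinuous.tendsto {h : E → ℝ} (hh : WeaklyContinuous h) {x : ℕ → E} {x₀ : E}
    (hx : WeaklyTendsto x x₀) : Tendsto (fun n => h (x n)) atTop (𝓝 (h x₀)) :=
  (Continuous.tendsto hh (toWeakSpace ℝ E x₀)).comp hx

theorem WeaklyContinuous.continuous {h : E → ℝ} (hh : WeaklyContinuous h) : Continuous h :=
  hh.comp (toWeakSpaceCLM ℝ E).continuous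

/-- Closed convex sets are weakly sequentially closed. -/
theorem WeaklyTendsto.eventually_notMem {s : Set E} (hs : IsClosed s) (hc : Convex ℝ s) {x : ℕ → E}
    {x₀ : E} (hx : WeaklyTendsto x x₀) (h : x₀ ∉ s) : ∀ᶠ n in atTop, x n ∉ s := by
  have hcl : IsClosed (toWeakSpace ℝ E '' s) := by
    rw [← closure_eq_iff_isClosed, ← hc.toWeakSpace_closure ℝ, hs.closure_eq]
  have := hx.eventually (hcl.isOpen_compl.mem_nhds (x := toWeakSpace ℝ E x₀) (by
    rintro ⟨y, hy, hyx⟩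
    exact h ((toWeakSpace ℝ E).injective hyx ▸ hy)))
  filter_upwards [this] with n hn hxn
  exact hn ⟨_, hxn, rfl⟩

/-- A compact operator maps bounded weakly convergent sequences to convergent ones. -/
theorem WeaklyTendsto.tendsto_of_isCompactOperator {F : Type*} [NormedAddCommGroup F]
    [NormedSpace ℝ F] {T : E →L[ℝ] F} (hT : IsCompactOperator T) {x : ℕ → E} {x₀ : E} {R : ℝ}
    (hb : ∀ n, ‖x n‖ ≤ R) (hx : WeaklyTendsto x x₀) :
    Tendsto (fun n => T (x n)) atTop (𝓝 (T x₀)) := by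
  have hK := hT.isCompact_closure_image_closedBall R
  refine hK.tendsto_nhds_of_unique_mapClusterPt
    (Eventually.of_forall fun n => subset_closure ⟨x n, by simpa using hb n, rfl⟩) ?_
  intro y _ hy
  refine SeparatingDual.eq_iff_forall_dual_eq (R := ℝ) |>.2 fun f => ?_
  have h1 : MapClusterPt (f y) atTop fun n => f (T (x n)) :=
    hy.continuousAt_comp f.continuous.continuousAt
  have h2 := weaklyTendsto_iff.1 (hx.comp_clm T) f
  exact eq_of_nhds_neBot (h1.clusterPt.mono h2 |>.neBot)

/-- In a reflexive space bounded ultrafilters converge weakly. -/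
theorem IsReflexive.exists_weak_limit (hE : IsReflexive E) (U : Ultrafilter E) {R : ℝ}
    (hU : ∀ᶠ x in (U : Filter E), ‖x‖ ≤ R) :
    ∃ w, ∀ f : StrongDual ℝ E, Tendsto f U (𝓝 (f w)) := by
  have key : ∀ f : StrongDual ℝ E, ∃ l : ℝ, ‖l‖ ≤ R * ‖f‖ ∧ Tendsto f U (𝓝 l) := by
    intro f
    have hmem : Metric.closedBall (0 : ℝ) (R * ‖f‖) ∈ U.map f := by
      rw [Ultrafilter.mem_map]
      filter_upwards [hU] with x hx
      simp only [Set.mem_preimage, mem_closedBall_zero_iff]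
      calc ‖f x‖ ≤ ‖f‖ * ‖x‖ := f.le_opNorm x
        _ ≤ ‖f‖ * R := by gcongr
        _ = R * ‖f‖ := mul_comm _ _
    obtain ⟨l, hl, hle⟩ := (isCompact_closedBall (0 : ℝ) (R * ‖f‖)).ultrafilter_le_nhds _
      (le_principal_iff.2 hmem)
    exact ⟨l, by simpa using hl, hle⟩
  choose l hl hlim using key
  let ξ : StrongDual ℝ E →ₗ[ℝ] ℝ :=
    { toFun := l
      map_add' := fun f g => tendsto_nhds_unique (hlim (f + g)) ((hlim f).add (hlim g))
      map_smul' := fun c f => tendsto_nhds_unique (hlim (c • f)) ((hlim f).const_mul c) }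
  obtain ⟨w, hw⟩ := hE (ξ.mkContinuous R hl)
  refine ⟨w, fun f => ?_⟩
  have : f w = l f := by
    have := congrArg (fun g => g f) hw
    simpa [ξ] using this
  rw [this]
  exact hlim f

/-- A functional on the product splits into its restrictions to the two factors, so a bidual element
is represented componentwise. -/
theorem IsReflexive.prod {F : Type*} [NormedAddCommGroup F] [NormedSpace ℝ F]
    (hE : IsReflexive E) (hF : IsReflexive F) : IsReflexive (E × F) := by
  intro ξ
  let a := ContinuousLinearMap.compL ℝ (E × F) E ℝ
  let b := ContinuousLinearMap.compL ℝ (E × F) F ℝ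
  obtain ⟨x, hx⟩ := hE (ξ.comp (a.flip (ContinuousLinearMap.fst ℝ E F)))
  obtain ⟨y, hy⟩ := hF (ξ.comp (b.flip (ContinuousLinearMap.snd ℝ E F)))
  refine ⟨(x, y), ?_⟩
  ext f
  let f₁ := f.comp (ContinuousLinearMap.inl ℝ E F)
  let f₂ := f.comp (ContinuousLinearMap.inr ℝ E F)
  have h1 := congrArg (fun g => g f₁) hx
  have h2 := congrArg (fun g => g f₂) hy
  have hf : f = f₁.comp (ContinuousLinearMap.fst ℝ E F) +
      f₂.comp (ContinuousLinearMap.snd ℝ E F) := by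
    refine ContinuousLinearMap.ext fun z => ?_
    simp [f₁, f₂, ← map_add]
  have h1' : f₁ x = ξ (f₁.comp (ContinuousLinearMap.fst ℝ E F)) := h1
  have h2' : f₂ y = ξ (f₂.comp (ContinuousLinearMap.snd ℝ E F)) := h2
  rw [NormedSpace.dual_def]
  conv_rhs => rw [hf, map_add, ← h1', ← h2']
  conv_lhs => rw [hf]
  simp

/-- The span of a finite set is normed, up to a factor `2`, by finitely many functionals. -/
theorem exists_finset_norming (S : Finset E) :
    ∃ Φ : Finset (StrongDual ℝ E), ∀ x ∈ Submodule.span ℝ (S : Set E), x ≠ 0 →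
      ∃ φ ∈ Φ, ‖φ‖ ≤ 1 ∧ ‖x‖ ≤ 2 * φ x := by
  classical
  set V := Submodule.span ℝ (S : Set E)
  have : FiniteDimensional ℝ V := FiniteDimensional.span_finset ℝ S
  have hK : IsCompact ((fun x : V => (x : E)) '' Metric.sphere 0 1) :=
    (isCompact_sphere _ _).image continuous_subtype_val
  choose φ hφ1 hφ using fun x : E => exists_dual_vector'' ℝ x
  obtain ⟨t, ht, hcov⟩ := hK.elim_nhds_subcover (fun x => {z | 1 / 2 < φ x z}) (by
    rintro _ ⟨x, hx, rfl⟩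
    refine (isOpen_lt continuous_const (φ x).continuous).mem_nhds ?_
    have hx1 : ‖(x : E)‖ = 1 := by simpa using hx
    change 1 / 2 < φ x x
    rw [hφ, hx1]; norm_num)
  refine ⟨t.image φ, fun x hx hx0 => ?_⟩
  have hn : 0 < ‖x‖ := norm_pos_iff.2 hx0
  have hmem : ‖x‖⁻¹ • x ∈ (fun x : V => (x : E)) '' Metric.sphere 0 1 := by
    refine ⟨⟨‖x‖⁻¹ • x, V.smul_mem _ hx⟩, ?_, rfl⟩
    simp [norm_smul, hn.ne']
  obtain ⟨y, hy, hlt⟩ := Set.mem_iUnion₂.1 (hcov hmem)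
  refine ⟨φ y, Finset.mem_image_of_mem _ hy, hφ1 y, ?_⟩
  have hlt' : 1 / 2 < ‖x‖⁻¹ * φ y x := by simpa using hlt
  rw [inv_mul_eq_div, lt_div_iff₀ hn] at hlt'
  linarith

/-- **Whitley's construction**: in a reflexive space, weak limits of ultrafilters on a bounded set
are weak limits of sequences in that set. -/
theorem IsReflexive.exists_seq_weaklyTendsto (hE : IsReflexive E) {A : Set E} {R : ℝ}
    (hA : ∀ x ∈ A, ‖x‖ ≤ R) (U : Ultrafilter E) (hAU : A ∈ U) {w : E}
    (hw : ∀ f : StrongDual ℝ E, Tendsto f U (𝓝 (f w))) :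
    ∃ x : ℕ → E, (∀ n, x n ∈ A) ∧ WeaklyTendsto x w := by
  classical
  choose Φ hΦ using fun S : Finset E => exists_finset_norming S
  have hstep : ∀ (S : Finset E) (n : ℕ), ∃ a ∈ A, ∀ T ⊆ S, ∀ φ ∈ Φ T,
      |φ a - φ w| < 1 / ((n : ℝ) + 1) := by
    intro S n
    have h1 : ∀ᶠ a in (U : Filter E), ∀ φ ∈ S.powerset.biUnion Φ,
        |φ a - φ w| < 1 / ((n : ℝ) + 1) := by
      rw [Filter.eventually_all_finset]
      intro φ _
      have := Metric.tendsto_nhds.1 (hw φ) (1 / ((n : ℝ) + 1)) (by positivity)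
      simpa [Real.dist_eq] using this
    obtain ⟨a, haA, ha⟩ := ((eventually_mem_set.2 hAU).and h1).exists
    exact ⟨a, haA, fun T hT φ hφ =>
      ha φ (Finset.mem_biUnion.2 ⟨T, Finset.mem_powerset.2 hT, hφ⟩)⟩
  choose a haA ha using hstep
  -- S n collects w and the points chosen so far. The next point agrees with w up to 1/(n + 1) on
  -- the norming functionals of every subset of S n, hence on all earlier families.
  let S : ℕ → Finset E := fun n => Nat.rec {w} (fun k s => insert (a s k) s) n
  have hS0 : S 0 = {w} := rfl
  have hSs : ∀ n, S (n + 1) = insert (a (S n) n) (S n) := fun n => rfl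
  have hmono : Monotone S := monotone_nat_of_le_succ fun n => by
    rw [hSs]; exact Finset.subset_insert _ _
  let x : ℕ → E := fun n => a (S n) n
  have hxS : ∀ n, x n ∈ S (n + 1) := fun n => by rw [hSs]; exact Finset.mem_insert_self _ _
  have hwS : ∀ n, w ∈ S n := fun n => hmono (Nat.zero_le n) (by simp [hS0])
  have hxA : ∀ n, x n ∈ A := fun n => haA _ _
  have hconv : ∀ m, ∀ φ ∈ Φ (S m), Tendsto (fun n => φ (x n)) atTop (𝓝 (φ w)) := by
    intro m φ hφ
    rw [tendsto_iff_norm_sub_tendsto_zero]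
    refine squeeze_zero' (Eventually.of_forall fun _ => norm_nonneg _) ?_
      tendsto_one_div_add_atTop_nhds_zero_nat
    filter_upwards [eventually_ge_atTop m] with n hn
    exact (ha (S n) n (S m) (hmono hn) φ hφ).le
  refine ⟨x, hxA, weaklyTendsto_iff.2 fun f => ?_⟩
  rw [tendsto_iff_ultrafilter]
  intro V hV
  obtain ⟨y, hy⟩ := hE.exists_weak_limit (V.map x) (R := R)
    (Eventually.of_forall (f := (V : Filter ℕ)) fun n => hA _ (hxA n))
  have hy' : ∀ g : StrongDual ℝ E, Tendsto (fun n => g (x n)) V (𝓝 (g y)) := fun g => hy g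
  -- Every subultrafilter has some weak limit y, so only y = w is left.
  suffices hyw : y = w by rw [← hyw]; exact hy' f
  let W : Submodule ℝ E := ⨆ n : ℕ, Submodule.span ℝ (SetLike.coe (S n))
  have hsub : ∀ z ∈ W, ∃ n : ℕ, z ∈ Submodule.span ℝ (SetLike.coe (S n)) := by
    intro z hz
    have hdir : Directed (· ≤ ·) fun n : ℕ => Submodule.span ℝ (SetLike.coe (S n)) :=
      Monotone.directed_le fun i j hij => Submodule.span_mono (by exact_mod_cast hmono hij)
    exact (Submodule.mem_iSup_of_directed _ hdir).1 hz
  have hxW : ∀ n, x n ∈ W := fun n =>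
    Submodule.mem_iSup_of_mem (n + 1) (Submodule.subset_span (hxS n))
  have hwW : w ∈ W := Submodule.mem_iSup_of_mem 0 (Submodule.subset_span (hwS 0))
  have hyW : y - w ∈ closure (W : Set E) := by
    by_contra hnot
    obtain ⟨g, u, hgu, hug⟩ := geometric_hahn_banach_closed_point
      (W.convex.closure) isClosed_closure hnot
    have hlim : Tendsto (fun n => g (x n - w)) V (𝓝 (g (y - w))) := by
      simpa using (hy' g).sub_const (g w)
    have := le_of_tendsto hlim (Eventually.of_forall fun n =>
      (hgu _ (subset_closure (W.sub_mem (hxW n) hwW))).le)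
    linarith
  have hzero : ∀ m, ∀ φ ∈ Φ (S m), φ (y - w) = 0 := by
    intro m φ hφ
    have h1 := tendsto_nhds_unique (hy' φ) ((hconv m φ hφ).mono_left hV)
    simp [h1]
  by_contra hne
  have hpos : 0 < ‖y - w‖ := norm_pos_iff.2 (sub_ne_zero.2 hne)
  -- The norming functionals vanish at y - w, so a nearby v in the span has ‖v‖ ≤ 2‖y - w - v‖.
  -- Hence ‖y - w‖ ≤ 3‖y - w - v‖ < (3/4)‖y - w‖.
  obtain ⟨v, hvW, hv⟩ := Metric.mem_closure_iff.1 hyW (‖y - w‖ / 4) (by positivity)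
  rw [dist_eq_norm] at hv
  have hv0 : v ≠ 0 := by
    rintro rfl
    rw [sub_zero] at hv
    linarith
  obtain ⟨m, hm⟩ := hsub v hvW
  obtain ⟨φ, hφ, hφ1, hle⟩ := hΦ (S m) v hm hv0
  have h1 : φ v ≤ ‖y - w - v‖ := by
    calc φ v = - φ (y - w - v) := by rw [map_sub, hzero m φ hφ]; ring
      _ ≤ ‖φ (y - w - v)‖ := neg_le_abs _
      _ ≤ ‖φ‖ * ‖y - w - v‖ := φ.le_opNorm _
      _ ≤ ‖y - w - v‖ := by nlinarith [norm_nonneg (y - w - v)]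
  have h2 : ‖y - w‖ ≤ ‖y - w - v‖ + ‖v‖ := by
    simpa using norm_add_le (y - w - v) v
  linarith

end Weak

/-! ### Calculus of Clarke's derivative -/

section Clarke

variable {E : Type*} [NormedAddCommGroup E] [NormedSpace ℝ E] {h : E → ℝ}

theorem tendsto_add_smul_nhds (x y : E) :
    Tendsto (fun p : E × ℝ => p.1 + p.2 • y) (𝓝 x ×ˢ 𝓝[>] (0 : ℝ)) (𝓝 x) := by
  have : Tendsto (fun p : E × ℝ => p.1 + p.2 • y) (𝓝 x ×ˢ 𝓝 (0 : ℝ)) (𝓝 x) := by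
    rw [← nhds_prod_eq]
    have : Continuous fun p : E × ℝ => p.1 + p.2 • y := by fun_prop
    simpa using this.tendsto (x, (0 : ℝ))
  exact this.mono_left (prod_mono le_rfl nhdsWithin_le_nhds)

theorem eventually_snd_pos {X : Type*} [TopologicalSpace X] (x : X) : ∀ᶠ p : X × ℝ in 𝓝 x ×ˢ 𝓝[>] (0 : ℝ), 0 < p.2 :=
  tendsto_snd.eventually (eventually_mem_nhdsWithin (a := (0 : ℝ)) (s := Set.Ioi 0))

theorem eventually_diffQuot_le {K : NNReal} {U : Set E} {x : E} (hU : U ∈ 𝓝 x)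
    (hK : LipschitzOnWith K h U) (y z : E) :
    ∀ᶠ p : E × ℝ in 𝓝 x ×ˢ 𝓝[>] (0 : ℝ), (h (p.1 + p.2 • y) - h p.1) / p.2 ≤
      (h (p.1 + p.2 • z) - h p.1) / p.2 + K * ‖y - z‖ := by
  filter_upwards [(tendsto_add_smul_nhds x y).eventually hU,
    (tendsto_add_smul_nhds x z).eventually hU, eventually_snd_pos x] with p hy hz hp
  have h1 := hK.norm_sub_le hy hz
  have h2 : p.1 + p.2 • y - (p.1 + p.2 • z) = p.2 • (y - z) := by rw [smul_sub]; abel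
  rw [h2, norm_smul, Real.norm_of_nonneg hp.le] at h1
  have h3 := (Real.le_norm_self _).trans h1
  rw [div_add' _ _ _ hp.ne']
  gcongr
  linarith

/-- Two-sided local bounds on the difference quotients make their real-valued `limsup` meaningful.
-/
theorem exists_forall_eventually_diffQuot (hh : LocallyLipschitz h) (x : E) : ∃ K : ℝ, 0 ≤ K ∧ ∀ y,
    ∀ᶠ p : E × ℝ in 𝓝 x ×ˢ 𝓝[>] (0 : ℝ), (h (p.1 + p.2 • y) - h p.1) / p.2 ≤ K * ‖y‖ ∧
      -(K * ‖y‖) ≤ (h (p.1 + p.2 • y) - h p.1) / p.2 := by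
  obtain ⟨K, U, hU, hK⟩ := hh x
  refine ⟨K, K.2, fun y => ?_⟩
  filter_upwards [eventually_diffQuot_le hU hK y 0, eventually_diffQuot_le hU hK 0 y] with p h1 h2
  simp only [smul_zero, add_zero, sub_self, zero_div, sub_zero, zero_add, zero_sub, norm_neg]
    at h1 h2
  exact ⟨h1, by linarith⟩

theorem clarkeDeriv_le_of_eventually (hh : LocallyLipschitz h) {x y : E} {a : ℝ}
    (ha : ∀ᶠ p : E × ℝ in 𝓝 x ×ˢ 𝓝[>] (0 : ℝ), (h (p.1 + p.2 • y) - h p.1) / p.2 ≤ a) :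
    clarkeDeriv h x y ≤ a := by
  obtain ⟨K, -, hK⟩ := exists_forall_eventually_diffQuot hh x
  have hb : IsBoundedUnder (· ≥ ·) (𝓝 x ×ˢ 𝓝[>] (0 : ℝ))
      fun p : E × ℝ => (h (p.1 + p.2 • y) - h p.1) / p.2 :=
    isBoundedUnder_of_eventually_ge ((hK y).mono fun _ hp => hp.2)
  exact limsup_le_of_le hb.isCoboundedUnder_le ha

theorem eventually_lt_of_clarkeDeriv_lt (hh : LocallyLipschitz h) {x y : E} {a : ℝ}
    (ha : clarkeDeriv h x y < a) :
    ∀ᶠ p : E × ℝ in 𝓝 x ×ˢ 𝓝[>] (0 : ℝ), (h (p.1 + p.2 • y) - h p.1) / p.2 < a := by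
  obtain ⟨K, -, hK⟩ := exists_forall_eventually_diffQuot hh x
  exact eventually_lt_of_limsup_lt ha
    (isBoundedUnder_of_eventually_le ((hK y).mono fun _ hp => hp.1))

theorem exists_forall_clarkeDeriv_le (hh : LocallyLipschitz h) (x : E) :
    ∃ K : ℝ, ∀ y, clarkeDeriv h x y ≤ K * ‖y‖ := by
  obtain ⟨K, -, hK⟩ := exists_forall_eventually_diffQuot hh x
  exact ⟨K, fun y => clarkeDeriv_le_of_eventually hh ((hK y).mono fun _ hp => hp.1)⟩

theorem clarkeDeriv_zero (h : E → ℝ) (x : E) : clarkeDeriv h x 0 = 0 := by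
  simp [clarkeDeriv]

theorem clarkeDeriv_add_le (hh : LocallyLipschitz h) (x y z : E) :
    clarkeDeriv h x (y + z) ≤ clarkeDeriv h x y + clarkeDeriv h x z := by
  refine le_of_forall_pos_le_add fun ε hε => ?_
  refine clarkeDeriv_le_of_eventually hh ?_
  have h1 := eventually_lt_of_clarkeDeriv_lt hh (lt_add_of_pos_right (clarkeDeriv h x y)
    (half_pos hε))
  have h2 := eventually_lt_of_clarkeDeriv_lt hh (lt_add_of_pos_right (clarkeDeriv h x z)
    (half_pos hε))
  -- The base point in the limsup is free to move, so it may be shifted to z + t y.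
  have ht : Tendsto (fun p : E × ℝ => (p.1 + p.2 • y, p.2)) (𝓝 x ×ˢ 𝓝[>] (0 : ℝ))
      (𝓝 x ×ˢ 𝓝[>] (0 : ℝ)) := (tendsto_add_smul_nhds x y).prodMk tendsto_snd
  filter_upwards [h1, ht.eventually h2] with p hp1 hp2
  have : (h (p.1 + p.2 • (y + z)) - h p.1) / p.2 =
      (h (p.1 + p.2 • y) - h p.1) / p.2 +
        (h (p.1 + p.2 • y + p.2 • z) - h (p.1 + p.2 • y)) / p.2 := by
    rw [smul_add, ← add_assoc]; ring
  rw [this]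
  linarith

theorem clarkeDeriv_smul_le (hh : LocallyLipschitz h) (x y : E) {s : ℝ} (hs : 0 < s) :
    clarkeDeriv h x (s • y) ≤ s * clarkeDeriv h x y := by
  refine le_of_forall_pos_le_add fun ε hε => ?_
  refine clarkeDeriv_le_of_eventually hh ?_
  have h1 := eventually_lt_of_clarkeDeriv_lt hh (lt_add_of_pos_right (clarkeDeriv h x y)
    (div_pos hε hs))
  have ht0 : Tendsto (fun t : ℝ => s * t) (𝓝[>] (0 : ℝ)) (𝓝[>] (0 : ℝ)) := by
    refine tendsto_nhdsWithin_iff.2 ⟨?_, ?_⟩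
    · have : Continuous fun t : ℝ => s * t := by fun_prop
      simpa using (this.tendsto 0).mono_left (nhdsWithin_le_nhds (s := Set.Ioi 0))
    · filter_upwards [self_mem_nhdsWithin] with t ht
      exact mul_pos hs ht
  have ht : Tendsto (fun p : E × ℝ => (p.1, s * p.2)) (𝓝 x ×ˢ 𝓝[>] (0 : ℝ))
      (𝓝 x ×ˢ 𝓝[>] (0 : ℝ)) := tendsto_fst.prodMk (ht0.comp tendsto_snd)
  filter_upwards [ht.eventually h1, eventually_snd_pos x] with p hp hpos
  have : (h (p.1 + p.2 • s • y) - h p.1) / p.2 =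
      s * ((h (p.1 + (s * p.2) • y) - h p.1) / (s * p.2)) := by
    rw [smul_smul, mul_comm p.2 s]; field_simp
  rw [this]
  calc _ ≤ s * (clarkeDeriv h x y + ε / s) := by gcongr
    _ = _ := by field_simp

theorem clarkeDeriv_smul (hh : LocallyLipschitz h) (x y : E) {s : ℝ} (hs : 0 < s) :
    clarkeDeriv h x (s • y) = s * clarkeDeriv h x y := by
  refine le_antisymm (clarkeDeriv_smul_le hh x y hs) ?_
  have := clarkeDeriv_smul_le hh x (s • y) (inv_pos.2 hs)
  rw [inv_smul_smul₀ hs.ne', inv_mul_eq_div, le_div_iff₀ hs] at this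
  linarith

theorem neg_clarkeDeriv_neg_le (hh : LocallyLipschitz h) (x y : E) :
    -clarkeDeriv h x (-y) ≤ clarkeDeriv h x y := by
  have := clarkeDeriv_add_le hh x y (-y)
  rw [add_neg_cancel, clarkeDeriv_zero] at this
  linarith

/-- Joint upper semicontinuity of Clarke's derivative. -/
theorem upperSemicontinuous_clarkeDeriv (hh : LocallyLipschitz h) :
    UpperSemicontinuous fun q : E × E => clarkeDeriv h q.1 q.2 := by
  rintro ⟨x, y⟩ a ha
  obtain ⟨b, hb, hba⟩ := exists_between ha
  obtain ⟨K, U, hU, hK⟩ := hh x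
  have h1 : ∀ᶠ x' in 𝓝 x, ∀ᶠ p : E × ℝ in 𝓝 x' ×ˢ 𝓝[>] (0 : ℝ),
      (h (p.1 + p.2 • y) - h p.1) / p.2 < b := by
    obtain ⟨pa, hpa, pb, hpb, hab⟩ :=
      eventually_prod_iff.1 (eventually_lt_of_clarkeDeriv_lt hh hb)
    filter_upwards [eventually_eventually_nhds.2 hpa] with x' hx'
    exact eventually_prod_iff.2 ⟨pa, hx', pb, hpb, hab⟩
  have h2 : ∀ᶠ x' in 𝓝 x, U ∈ 𝓝 x' := eventually_mem_nhds_iff.2 hU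
  have h3 : ∀ᶠ y' in 𝓝 y, b + K * ‖y' - y‖ < a := by
    have : Continuous fun y' : E => b + K * ‖y' - y‖ := by fun_prop
    exact this.continuousAt.eventually (gt_mem_nhds (by simpa using hba))
  rw [nhds_prod_eq]
  filter_upwards [(h1.and h2).prod_mk h3] with ⟨x', y'⟩ ⟨⟨hx1, hx2⟩, hy⟩
  refine lt_of_le_of_lt (clarkeDeriv_le_of_eventually hh ?_) hy
  filter_upwards [hx1, eventually_diffQuot_le hx2 hK y' y] with p hp1 hp2
  linarith

/-- Clarke's derivative is the support function of the Clarke subdifferential. -/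
theorem exists_mem_clarkeSubdiff_eq (hh : LocallyLipschitz h) (x y : E) :
    ∃ ξ ∈ clarkeSubdiff h x, ξ y = clarkeDeriv h x y := by
  obtain ⟨K, hK⟩ := exists_forall_clarkeDeriv_le hh x
  suffices H : ∃ g : E →ₗ[ℝ] ℝ, g y = clarkeDeriv h x y ∧ ∀ z, g z ≤ clarkeDeriv h x z by
    obtain ⟨g, hgy, hg⟩ := H
    refine ⟨g.mkContinuous K fun z => ?_, fun z => hg z, hgy⟩
    rw [Real.norm_eq_abs, abs_le]
    have h1 := (hg (-z)).trans (hK (-z))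
    rw [map_neg, norm_neg] at h1
    exact ⟨by linarith, (hg z).trans (hK z)⟩
  have hpos : ∀ c : ℝ, 0 < c → ∀ z, clarkeDeriv h x (c • z) = c * clarkeDeriv h x z :=
    fun c hc z => clarkeDeriv_smul hh x z hc
  by_cases hy : y = 0
  · obtain ⟨g, -, hg⟩ := exists_extension_of_le_sublinear (⟨⊥, 0⟩ : E →ₗ.[ℝ] ℝ)
      (clarkeDeriv h x) hpos (clarkeDeriv_add_le hh x) (by
        rintro ⟨z, hz⟩
        have : z = 0 := by simpa using hz
        simp [this, clarkeDeriv_zero])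
    exact ⟨g, by simp [hy, clarkeDeriv_zero], hg⟩
  · obtain ⟨g, hg1, hg⟩ := exists_extension_of_le_sublinear
      (LinearPMap.mkSpanSingleton (K := ℝ) y (clarkeDeriv h x y) hy)
      (clarkeDeriv h x) hpos (clarkeDeriv_add_le hh x) (by
        rintro ⟨z, hz⟩
        obtain ⟨c, rfl⟩ := Submodule.mem_span_singleton.1 hz
        rw [LinearPMap.mkSpanSingleton'_apply]
        simp only [smul_eq_mul, RingHom.id_apply]
        rcases lt_trichotomy c 0 with hc | rfl | hc
        · have h1 := hpos (-c) (neg_pos.2 hc) y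
          have h2 := neg_clarkeDeriv_neg_le hh x (c • y)
          rw [← neg_smul] at h2
          linarith
        · simp [clarkeDeriv_zero]
        · exact (hpos c hc y).ge)
    refine ⟨g, ?_, hg⟩
    have := hg1 ⟨y, Submodule.mem_span_singleton_self y⟩
    exact this.trans (LinearPMap.mkSpanSingleton_apply ℝ ℝ hy (clarkeDeriv h x y))

end Clarke

/-! ### Minty pairs from the three conditions -/

section MintyPair

variable {E Z : Type*} [NormedAddCommGroup E] [NormedSpace ℝ E]
  [NormedAddCommGroup Z] [NormedSpace ℝ Z]

/-- The bifunction `⟨A u, v - u⟩ - c(u) h⁰(γ u; γ (v - u))`. -/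
noncomputable def hemiForm (A : E → StrongDual ℝ E) (c : E → ℝ) (γ : E →L[ℝ] Z) (h : Z → ℝ)
    (u v : E) : ℝ :=
  A u (v - u) - c u * clarkeDeriv h (γ u) (γ (v - u))

/-- `g` is a weakly lower semicontinuous minorant of the bifunction `f` from which `f` is recovered
along segments, as in Minty's lemma. -/
structure IsMintyPair (f g : E → E → ℝ) : Prop where
  le : ∀ u v, g u v ≤ f u v
  lsc : ∀ (v : E) (x : ℕ → E) (u : E) (R : ℝ), (∀ n, ‖x n‖ ≤ R) → WeaklyTendsto x u →
    ∀ a < g u v, ∀ᶠ n in atTop, a < g (x n) v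
  ray : ∀ u v : E, ∀ ε > 0, ∀ᶠ t : ℝ in 𝓝[>] 0, t * (f u v - ε) ≤ g u (u + t • (v - u))

theorem eventually_mul_clarkeDeriv_lt {ι : Type*} {l : Filter ι} {h : Z → ℝ}
    (hh : LocallyLipschitz h) {c : ι → ℝ} {c₀ : ℝ} {x y : ι → Z} {x₀ y₀ : Z}
    (hc : Tendsto c l (𝓝 c₀)) (hc₀ : 0 < c₀) (hx : Tendsto x l (𝓝 x₀)) (hy : Tendsto y l (𝓝 y₀))
    {b : ℝ} (hb : c₀ * clarkeDeriv h x₀ y₀ < b) :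
    ∀ᶠ i in l, c i * clarkeDeriv h (x i) (y i) < b := by
  obtain ⟨d, hd, hdb⟩ := exists_between ((lt_div_iff₀' hc₀).2 hb)
  have h1 : ∀ᶠ i in l, clarkeDeriv h (x i) (y i) < d :=
    (hx.prodMk_nhds hy).eventually (upperSemicontinuous_clarkeDeriv hh (x₀, y₀) d hd)
  have h2 : ∀ᶠ i in l, c i * d < b :=
    (hc.mul_const d).eventually_lt_const ((lt_div_iff₀' hc₀).1 hdb)
  filter_upwards [h1, h2, hc.eventually_const_lt hc₀] with i hi1 hi2 hi3
  exact (mul_le_mul_of_nonneg_left hi1.le hi3.le).trans_lt hi2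

/-- A concave dissipativity modulus is nonpositive as soon as the operator admits selections that
are asymptotically continuous at the origin along rays. -/
theorem RelaxedDissipative.nonpos {β : E → ℝ} {T : E → Set (StrongDual ℝ E)}
    (hT : RelaxedDissipative β T) (hβ : ConcaveOn ℝ Set.univ β) (hβ0 : β 0 ≤ 0) (w : E)
    (hsel : ∀ ε > 0, ∃ᶠ t : ℝ in 𝓝[>] 0, ∃ ζ ∈ T (t • -w), ∃ ζ₀ ∈ T 0, (ζ - ζ₀) w ≤ ε) :
    β w ≤ 0 := by
  refine le_of_forall_pos_le_add fun ε hε => ?_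
  obtain ⟨t, ⟨ζ, hζ, ζ₀, hζ₀, hle⟩, ht⟩ := ((hsel ε hε).and_eventually self_mem_nhdsWithin).exists
  have ht : 0 < t := ht
  have h1 := hT 0 (t • -w) ζ₀ hζ₀ ζ hζ
  rw [sub_zero, map_smul, map_neg, smul_eq_mul] at h1
  -- The origin is a convex combination of w and -t w, so t β(w) + β(-t w) ≤ (1 + t) β(0) ≤ 0, while
  -- dissipativity bounds β(-t w) below by -t ε.
  have h2 := hβ.2 (Set.mem_univ w) (Set.mem_univ (t • -w)) 
    (by positivity : 0 ≤ t / (1 + t)) (by positivity : 0 ≤ 1 / (1 + t)) (by field_simp; ring)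
  have h3 : (t / (1 + t)) • w + (1 / (1 + t)) • t • -w = 0 := by
    rw [smul_smul, smul_neg, div_mul_eq_mul_div, one_mul, add_neg_cancel]
  rw [h3, smul_eq_mul, smul_eq_mul] at h2
  have h4 : t / (1 + t) * β w + 1 / (1 + t) * β (t • -w) =
      (t * β w + β (t • -w)) / (1 + t) := by ring
  rw [h4, div_le_iff₀ (by positivity)] at h2
  have h5 : β 0 * (1 + t) ≤ 0 := mul_nonpos_of_nonpos_of_nonneg hβ0 (by positivity)
  have h6 : t * (β w) ≤ t * ε := by nlinarith
  rw [zero_add]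
  exact le_of_mul_le_mul_left h6 ht

variable {A : E → StrongDual ℝ E} {c : E → ℝ} {γ : E →L[ℝ] Z} {h : Z → ℝ}

theorem Hemicontinuous.tendsto_ray (hA : Hemicontinuous A) (w z : E) :
    Tendsto (fun t : ℝ => A (t • w) z) (𝓝[>] 0) (𝓝 (A 0 z)) := by
  simpa using hA 0 w z

theorem tendsto_add_smul_zero (u w : E) :
    Tendsto (fun t : ℝ => u + t • w) (𝓝[>] 0) (𝓝 u) := by
  have : Continuous fun t : ℝ => u + t • w := by fun_prop
  simpa using (this.tendsto 0).mono_left (nhdsWithin_le_nhds (s := Set.Ioi 0))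

theorem CondH2.dissipative (hA : CondH2 A) (u v : E) : A v (v - u) ≤ A u (v - u) := by
  obtain ⟨hemi, β, hβ, hβ0, hT⟩ := hA
  have h1 := hT u v (A u) rfl (A v) rfl
  have h2 : β (v - u) ≤ 0 := by
    refine hT.nonpos hβ hβ0 _ fun ε hε => Eventually.frequently ?_
    filter_upwards [(hemi.tendsto_ray (-(v - u)) (v - u)).eventually_lt_const
      (lt_add_of_pos_right _ hε)] with t ht
    refine ⟨_, rfl, _, rfl, ?_⟩
    rw [sub_apply]
    linarith
  rw [sub_apply] at h1
  linarith

theorem CondH3.dissipative (hh : LocallyLipschitz h) (hc : WeaklyContinuous c) (hc0 : ∀ u, 0 < c u)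
    (hA : CondH3 A c γ h) (u v : E) :
    A v (v - u) + c v * clarkeDeriv h (γ v) (γ (u - v)) ≤ hemiForm A c γ h u v := by
  obtain ⟨hemi, β, hβ, hβ0, hT⟩ := hA
  obtain ⟨ξu, hξu, hu⟩ := exists_mem_clarkeSubdiff_eq hh (γ u) (γ (v - u))
  obtain ⟨ξv, hξv, hv⟩ := exists_mem_clarkeSubdiff_eq hh (γ v) (γ (u - v))
  have h1 := hT u v _ ⟨ξu, hξu, rfl⟩ _ ⟨ξv, hξv, rfl⟩
  have h2 : β (v - u) ≤ 0 := by
    set w := v - u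
    refine hT.nonpos hβ hβ0 _ fun ε hε => Eventually.frequently ?_
    -- With ξ₀ extremal in direction -w, upper semicontinuity alone controls any selection at t •
    -- -w.
    obtain ⟨ξ₀, hξ₀, h₀⟩ := exists_mem_clarkeSubdiff_eq hh (γ 0) (γ (-w))
    have hlim : Tendsto (fun t : ℝ => t • -w) (𝓝[>] 0) (𝓝 0) := by
      simpa using tendsto_add_smul_zero 0 (-w)
    have e1 := eventually_mul_clarkeDeriv_lt hh ((hc.continuous.tendsto 0).comp hlim) (hc0 0)
      ((γ.continuous.tendsto 0).comp hlim) (tendsto_const_nhds (x := γ (-w)))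
      (lt_add_of_pos_right _ (half_pos hε))
    filter_upwards [(hemi.tendsto_ray (-w) w).eventually_lt_const
      (lt_add_of_pos_right _ (half_pos hε)), e1] with t ht1 ht2
    obtain ⟨ξ, hξ, -⟩ := exists_mem_clarkeSubdiff_eq hh (γ (t • -w)) 0
    refine ⟨_, ⟨ξ, hξ, rfl⟩, _, ⟨ξ₀, hξ₀, rfl⟩, ?_⟩
    have h3 := mul_le_mul_of_nonneg_left (hξ (γ (-w))) (hc0 (t • -w)).le
    rw [← h₀] at ht2
    simp only [sub_apply, smul_apply,
      ContinuousLinearMap.comp_apply, smul_eq_mul, Function.comp_apply, map_neg] at *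
    linarith
  have h3 : ξv (γ (v - u)) = -clarkeDeriv h (γ v) (γ (u - v)) := by
    rw [← hv, ← map_neg, ← map_neg, neg_sub]
  simp only [sub_apply, smul_apply,
    ContinuousLinearMap.comp_apply, smul_eq_mul] at h1
  rw [h3, hu] at h1
  unfold hemiForm
  linarith

/-- Compactness of γ turns weak into strong convergence, where Clarke's derivative is jointly upper
semicontinuous. -/
theorem eventually_mul_clarkeDeriv_sub_lt (hh : LocallyLipschitz h) (hγ : IsCompactOperator γ)
    (hc : WeaklyContinuous c) (hc0 : ∀ u, 0 < c u) {x : ℕ → E} {u v : E} {R b : ℝ} (hR : ∀ n, ‖x n‖ ≤ R)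
    (hx : WeaklyTendsto x u) (hb : c u * clarkeDeriv h (γ u) (γ (v - u)) < b) :
    ∀ᶠ n in atTop, c (x n) * clarkeDeriv h (γ (x n)) (γ (v - x n)) < b := by
  have hγx := hx.tendsto_of_isCompactOperator hγ hR
  refine eventually_mul_clarkeDeriv_lt hh (hc.tendsto hx) (hc0 u) hγx ?_ hb
  simpa using hγx.const_sub (γ v)

theorem hemiForm_ray (hh : LocallyLipschitz h) (u v : E) {t : ℝ} (ht : 0 < t) :
    hemiForm A c γ h u (u + t • (v - u)) = t * hemiForm A c γ h u v := by
  unfold hemiForm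
  rw [add_sub_cancel_left, map_smul, map_smul, clarkeDeriv_smul hh _ _ ht, smul_eq_mul]
  ring

theorem CondH1.isMintyPair (hh : LocallyLipschitz h) (hγ : IsCompactOperator γ)
    (hc : WeaklyContinuous c) (hc0 : ∀ u, 0 < c u) (hA : CondH1 A) :
    IsMintyPair (hemiForm A c γ h) (hemiForm A c γ h) where
  le _ _ := le_rfl
  lsc v x u R hR hx a ha := by
    unfold hemiForm at ha ⊢
    set ε := A u (v - u) - c u * clarkeDeriv h (γ u) (γ (v - u)) - a
    have hε : 0 < ε := by simp only [ε]; linarith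
    have h1 : ∀ᶠ n in atTop, A u (v - u) - ε / 2 < A (x n) (v - x n) := by
      have : ((A u (v - u) - ε / 2 : ℝ) : EReal) <
          liminf (fun n => ((A (x n) (v - x n) : ℝ) : EReal)) atTop :=
        lt_of_lt_of_le (EReal.coe_lt_coe_iff.2 (by linarith)) (hA v x u hx)
      filter_upwards [eventually_lt_of_lt_liminf this] with n hn
      exact EReal.coe_lt_coe_iff.1 hn
    filter_upwards [h1, eventually_mul_clarkeDeriv_sub_lt hh hγ hc hc0 (v := v) hR hx
      (lt_add_of_pos_right _ (half_pos hε))] with n hn1 hn2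
    simp only [ε] at hn1 hn2
    linarith
  ray u v ε hε := by
    filter_upwards [self_mem_nhdsWithin] with t ht
    rw [hemiForm_ray hh u v ht]
    exact mul_le_mul_of_nonneg_left (by linarith) (le_of_lt ht)

theorem CondH2.isMintyPair (hh : LocallyLipschitz h) (hγ : IsCompactOperator γ)
    (hc : WeaklyContinuous c) (hc0 : ∀ u, 0 < c u) (hA : CondH2 A) :
    IsMintyPair (hemiForm A c γ h)
      (fun u v => A v (v - u) - c u * clarkeDeriv h (γ u) (γ (v - u))) where
  le u v := sub_le_sub_right (hA.dissipative u v) _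
  lsc v x u R hR hx a ha := by
    set ε := A v (v - u) - c u * clarkeDeriv h (γ u) (γ (v - u)) - a
    have hε : 0 < ε := by simp only [ε]; linarith
    have h1 : Tendsto (fun n => A v (v - x n)) atTop (𝓝 (A v (v - u))) := by
      simpa using (weaklyTendsto_iff.1 hx (A v)).const_sub (A v v)
    filter_upwards [h1.eventually_const_lt (sub_lt_self _ (half_pos hε)),
      eventually_mul_clarkeDeriv_sub_lt hh hγ hc hc0 (v := v) hR hx
      (lt_add_of_pos_right _ (half_pos hε))] with n hn1 hn2
    simp only [ε] at hn1 hn2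
    linarith
  ray u v ε hε := by
    filter_upwards [self_mem_nhdsWithin, (hA.1 u v (v - u)).eventually_const_lt
      (sub_lt_self _ hε)] with t ht ht2
    have ht : 0 < t := ht
    rw [add_sub_cancel_left, map_smul, map_smul, clarkeDeriv_smul hh _ _ ht, smul_eq_mul]
    have h1 : t * (A u (v - u) - ε) ≤ t * A (u + t • (v - u)) (v - u) := by gcongr
    unfold hemiForm
    linarith

/-- Here the Clarke term must move to the test point along with A. Weak lower semicontinuity follows
from subadditivity and h⁰(·; 0) = 0; on segments, -h⁰(z; -y) ≤ h⁰(z; y) and upper semicontinuity at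
u restore the original term. -/
theorem CondH3.isMintyPair (hh : LocallyLipschitz h) (hγ : IsCompactOperator γ)
    (hc : WeaklyContinuous c) (hc0 : ∀ u, 0 < c u) (hA : CondH3 A c γ h) :
    IsMintyPair (hemiForm A c γ h)
      (fun u v => A v (v - u) + c v * clarkeDeriv h (γ v) (γ (u - v))) where
  le u v := hA.dissipative hh hc hc0 u v
  lsc v x u R hR hx a ha := by
    set ε := A v (v - u) + c v * clarkeDeriv h (γ v) (γ (u - v)) - a
    have hε : 0 < ε := by simp only [ε]; linarith
    have h1 : Tendsto (fun n => A v (v - x n)) atTop (𝓝 (A v (v - u))) := by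
      simpa using (weaklyTendsto_iff.1 hx (A v)).const_sub (A v v)
    have h2 : Tendsto (fun n => γ (u - x n)) atTop (𝓝 0) := by
      simpa using (hx.tendsto_of_isCompactOperator hγ hR).const_sub (γ u)
    filter_upwards [h1.eventually_const_lt (sub_lt_self _ (half_pos hε)),
      eventually_mul_clarkeDeriv_lt hh (tendsto_const_nhds (x := c v)) (hc0 v)
        (tendsto_const_nhds (x := γ v)) h2 (b := ε / 2)
        (by rw [clarkeDeriv_zero]; linarith)] with n hn1 hn2
    have h3 := clarkeDeriv_add_le hh (γ v) (γ (u - x n)) (γ (x n - v))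
    rw [← map_add, sub_add_sub_cancel] at h3
    have h4 := mul_le_mul_of_nonneg_left h3 (hc0 v).le
    simp only [ε] at hn1 hn2
    linarith
  ray u v ε hε := by
    have hlim := tendsto_add_smul_zero u (v - u)
    filter_upwards [self_mem_nhdsWithin, (hA.1 u v (v - u)).eventually_const_lt
      (sub_lt_self _ (half_pos hε)),
      eventually_mul_clarkeDeriv_lt hh ((hc.continuous.tendsto u).comp hlim) (hc0 u)
        ((γ.continuous.tendsto u).comp hlim) (tendsto_const_nhds (x := γ (v - u)))
        (lt_add_of_pos_right _ (half_pos hε))] with t ht ht2 ht3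
    have ht : 0 < t := ht
    simp only [Function.comp_apply] at ht3
    set z := u + t • (v - u)
    have hz1 : z - u = t • (v - u) := add_sub_cancel_left _ _
    have hz2 : u - z = t • -(v - u) := by rw [← neg_sub, hz1, smul_neg]
    rw [hz1, hz2, map_smul, map_smul, clarkeDeriv_smul hh _ _ ht, smul_eq_mul, map_neg]
    have h1 := mul_le_mul_of_nonneg_left (neg_clarkeDeriv_neg_le hh (γ z) (γ (v - u)))
      (hc0 z).le
    have h2 : hemiForm A c γ h u v - ε ≤
        A z (v - u) + c z * clarkeDeriv h (γ z) (-γ (v - u)) := by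
      unfold hemiForm
      linarith
    calc t * (hemiForm A c γ h u v - ε)
        ≤ t * (A z (v - u) + c z * clarkeDeriv h (γ z) (-γ (v - u))) := by gcongr
      _ = _ := by ring

theorem exists_isMintyPair (hh : LocallyLipschitz h) (hγ : IsCompactOperator γ)
    (hc : WeaklyContinuous c) (hc0 : ∀ u, 0 < c u) (hA : CondH1 A ∨ CondH2 A ∨ CondH3 A c γ h) :
    ∃ g, IsMintyPair (hemiForm A c γ h) g := by
  rcases hA with hA | hA | hA
  · exact ⟨_, hA.isMintyPair hh hγ hc hc0⟩
  · exact ⟨_, hA.isMintyPair hh hγ hc hc0⟩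
  · exact ⟨_, hA.isMintyPair hh hγ hc hc0⟩

end MintyPair

/-! ### Equilibrium problems governed by a Minty pair -/

section Equilibrium

variable {E Z : Type*} [NormedAddCommGroup E] [NormedSpace ℝ E]
  [NormedAddCommGroup Z] [NormedSpace ℝ Z]

theorem hemiForm_self (A : E → StrongDual ℝ E) (c : E → ℝ) (γ : E →L[ℝ] Z) (h : Z → ℝ) (u : E) :
    hemiForm A c γ h u u = 0 := by
  simp [hemiForm, clarkeDeriv_zero]

theorem concaveOn_hemiForm (A : E → StrongDual ℝ E) {c : E → ℝ} (γ : E →L[ℝ] Z) {h : Z → ℝ}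
    (hh : LocallyLipschitz h) (hc0 : ∀ u, 0 < c u) (u : E) :
    ConcaveOn ℝ Set.univ (hemiForm A c γ h u) := by
  refine ⟨convex_univ, fun v _ w _ a b ha hb hab => ?_⟩
  have hs : ∀ s : ℝ, 0 ≤ s → ∀ z, clarkeDeriv h (γ u) (s • z) = s * clarkeDeriv h (γ u) z := by
    intro s hs z
    rcases hs.eq_or_lt with rfl | hs
    · simp [clarkeDeriv_zero]
    · exact clarkeDeriv_smul hh _ _ hs
  have h1 : a • v + b • w - u = a • (v - u) + b • (w - u) := by
    have : u = (a + b) • u := by rw [hab, one_smul]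
    conv_lhs => rw [this]
    simp only [smul_sub, add_smul]
    abel
  have h2 := clarkeDeriv_add_le hh (γ u) (a • γ (v - u)) (b • γ (w - u))
  rw [hs a ha, hs b hb] at h2
  have h3 := mul_le_mul_of_nonneg_left h2 (hc0 u).le
  unfold hemiForm
  rw [h1]
  simp only [map_add, map_smul, smul_eq_mul]
  linarith

theorem IsMintyPair.prod {F : Type*} [NormedAddCommGroup F] [NormedSpace ℝ F]
    {f₁ g₁ : E → E → ℝ} {f₂ g₂ : F → F → ℝ} (h₁ : IsMintyPair f₁ g₁) (h₂ : IsMintyPair f₂ g₂) :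
    IsMintyPair (fun u v : E × F => f₁ u.1 v.1 + f₂ u.2 v.2)
      (fun u v : E × F => g₁ u.1 v.1 + g₂ u.2 v.2) where
  le u v := add_le_add (h₁.le _ _) (h₂.le _ _)
  lsc v x u R hR hx a ha := by
    have hx1 : WeaklyTendsto (fun n => (x n).1) u.1 := hx.comp_clm (ContinuousLinearMap.fst ℝ E F)
    have hx2 : WeaklyTendsto (fun n => (x n).2) u.2 := hx.comp_clm (ContinuousLinearMap.snd ℝ E F)
    filter_upwards [h₁.lsc v.1 _ _ R (fun n => (norm_fst_le _).trans (hR n)) hx1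
        (g₁ u.1 v.1 - (g₁ u.1 v.1 + g₂ u.2 v.2 - a) / 2) (by linarith),
      h₂.lsc v.2 _ _ R (fun n => (norm_snd_le _).trans (hR n)) hx2
        (g₂ u.2 v.2 - (g₁ u.1 v.1 + g₂ u.2 v.2 - a) / 2) (by linarith)] with n hn1 hn2
    linarith
  ray u v ε hε := by
    filter_upwards [h₁.ray u.1 v.1 (ε / 2) (half_pos hε),
      h₂.ray u.2 v.2 (ε / 2) (half_pos hε)] with t ht1 ht2
    simp only [Prod.fst_add, Prod.snd_add, Prod.smul_fst, Prod.smul_snd, Prod.fst_sub,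
      Prod.snd_sub]
    linarith

variable {C D : Set E} {ψ : E → ℝ} {f g : E → E → ℝ}

/-- The candidate points dominated by `v` in the relaxed equilibrium problem. -/
def mintySet (C D : Set E) (ψ : E → ℝ) (g : E → E → ℝ) (v : E) : Set E :=
  {u | u ∈ C ∩ D ∧ ψ u + g u v ≤ ψ v}

theorem mem_mintySet_of_weaklyTendsto (hCc : IsClosed C) (hC : Convex ℝ C) {R : ℝ}
    (hR : ∀ x ∈ C, ‖x‖ ≤ R) (hψ : ConvexOn ℝ D ψ) (hψc : ∀ a, IsClosed {x | x ∈ D ∧ ψ x ≤ a})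
    (hfg : IsMintyPair f g) {v u : E} {x : ℕ → E} (hx : ∀ n, x n ∈ mintySet C D ψ g v)
    (hxu : WeaklyTendsto x u) : u ∈ mintySet C D ψ g v := by
  have huC : u ∈ C := by
    by_contra h
    obtain ⟨n, hn⟩ := (hxu.eventually_notMem hCc hC h).exists
    exact hn (hx n).1.1
  -- Sublevel sets of ψ in D are closed and convex, hence weakly sequentially closed.
  have key : ∀ ε > 0, u ∈ D ∧ ψ u ≤ ψ v - g u v + ε := by
    intro ε hε
    by_contra h
    obtain ⟨n, hn, hn'⟩ := ((hxu.eventually_notMem (hψc _) (hψ.convex_le _) h).and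
      (hfg.lsc v x u R (fun n => hR _ (hx n).1.1) hxu _ (sub_lt_self _ hε))).exists
    exact hn ⟨(hx n).1.2, by linarith [(hx n).2]⟩
  refine ⟨⟨huC, (key 1 one_pos).1⟩, ?_⟩
  have := le_of_forall_pos_le_add fun ε hε => (key ε hε).2
  linarith

theorem isClosed_mintySet (hCc : IsClosed C) (hC : Convex ℝ C) {R : ℝ}
    (hR : ∀ x ∈ C, ‖x‖ ≤ R) (hψ : ConvexOn ℝ D ψ) (hψc : ∀ a, IsClosed {x | x ∈ D ∧ ψ x ≤ a})
    (hfg : IsMintyPair f g) (v : E) : IsClosed (mintySet C D ψ g v) := by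
  refine IsSeqClosed.isClosed fun x u hx hxu => ?_
  exact mem_mintySet_of_weaklyTendsto hCc hC hR hψ hψc hfg hx
    (weaklyTendsto_iff.2 fun φ => (φ.continuous.tendsto u).comp hxu)

/-- Finitely many of the sets `mintySet C D ψ g v` have a common point. -/
theorem exists_forall_mem_mintySet (hCc : IsClosed C) (hC : Convex ℝ C) {R : ℝ}
    (hR : ∀ x ∈ C, ‖x‖ ≤ R) (hψ : ConvexOn ℝ D ψ) (hψc : ∀ a, IsClosed {x | x ∈ D ∧ ψ x ≤ a})
    (hfg : IsMintyPair f g) (hfc : ∀ u, ConcaveOn ℝ Set.univ (f u)) (hf0 : ∀ u, f u u = 0)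
    (S : Finset E) (hS : ∀ v ∈ S, v ∈ C ∩ D) : ∃ u, ∀ v ∈ S, u ∈ mintySet C D ψ g v := by
  rcases S.eq_empty_or_nonempty with rfl | hne
  · exact ⟨0, by simp⟩
  have : Nonempty S := hne.coe_sort
  let T : (S → ℝ) → E := fun l => ∑ i, l i • (i : E)
  have hT : Continuous T := by fun_prop
  obtain ⟨l, -, hl⟩ := exists_mem_stdSimplex_forall_mem
    (C := fun i : S => T ⁻¹' mintySet C D ψ g i)
    (fun i => (isClosed_mintySet hCc hC hR hψ hψc hfg _).preimage hT) (by
      intro l hl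
      have hTC : T l ∈ C ∩ D :=
        (hC.inter hψ.1).sum_mem (fun i _ => hl.1 i) hl.2 fun i _ => hS i i.2
      by_contra! hcon
      -- If the covering failed at `T l`, averaging these strict inequalities with weights l would
      -- contradict convexity of ψ, concavity of f (T l) and f (T l) (T l) = 0.
      have hlt : ∀ i, 0 < l i → ψ i < ψ (T l) + f (T l) i := by
        intro i hi
        by_contra! hle
        exact hcon i hi ⟨hTC, (add_le_add_right (hfg.le _ _) _).trans hle⟩
      have h1 : ψ (T l) ≤ ∑ i, l i * ψ i :=
        hψ.map_sum_le (fun i _ => hl.1 i) hl.2 fun i _ => (hS i i.2).2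
      have h2 : ∑ i, l i * f (T l) i ≤ f (T l) (T l) :=
        (hfc (T l)).le_map_sum (fun i _ => hl.1 i) hl.2 fun i _ => Set.mem_univ _
      have h3 : ∑ i, l i * ψ i < ∑ i, l i * (ψ (T l) + f (T l) i) := by
        obtain ⟨i, hi⟩ : ∃ i, 0 < l i := by
          by_contra! h
          have := Finset.sum_nonpos fun i (_ : i ∈ Finset.univ) => h i
          linarith [hl.2]
        refine Finset.sum_lt_sum (fun j _ => ?_)
          ⟨i, Finset.mem_univ _, mul_lt_mul_of_pos_left (hlt i hi) hi⟩
        rcases (hl.1 j).eq_or_lt with h0 | h0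
        · simp [← h0]
        · exact (mul_lt_mul_of_pos_left (hlt j h0) h0).le
      simp only [mul_add, Finset.sum_add_distrib, ← Finset.sum_mul, hl.2, one_mul] at h3
      linarith [hf0 (T l)])
  exact ⟨T l, fun v hv => hl ⟨v, hv⟩⟩

/-- Existence for equilibrium problems `f u v ≤ ψ v - ψ u` governed by a Minty pair. -/
theorem exists_equilibrium (hE : IsReflexive E) (hCc : IsClosed C) (hC : Convex ℝ C)
    (hCb : Bornology.IsBounded C) (hψ : ConvexOn ℝ D ψ)
    (hψc : ∀ a, IsClosed {x | x ∈ D ∧ ψ x ≤ a}) (hCD : (C ∩ D).Nonempty)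
    (hfg : IsMintyPair f g) (hfc : ∀ u, ConcaveOn ℝ Set.univ (f u)) (hf0 : ∀ u, f u u = 0) :
    ∃ u ∈ C ∩ D, ∀ v ∈ C ∩ D, f u v ≤ ψ v - ψ u := by
  classical
  obtain ⟨R, hR⟩ := hCb.exists_norm_le
  obtain ⟨U, hU⟩ := Ultrafilter.exists_ultrafilter_of_finite_inter_nonempty
    (mintySet C D ψ g '' (C ∩ D)) (by
      intro T hT
      obtain ⟨S, hS, rfl⟩ := Finset.subset_set_image_iff.1 hT
      obtain ⟨u, hu⟩ := exists_forall_mem_mintySet hCc hC hR hψ hψc hfg hfc hf0 S fun v hv => hS hv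
      exact ⟨u, by simpa using hu⟩)
  have hmem : ∀ v ∈ C ∩ D, mintySet C D ψ g v ∈ U := fun v hv => hU ⟨v, hv, rfl⟩
  obtain ⟨v₀, hv₀⟩ := hCD
  obtain ⟨u, hu⟩ := hE.exists_weak_limit U (R := R) (by
    filter_upwards [hmem v₀ hv₀] with x hx
    exact hR x hx.1.1)
  have huv : ∀ v ∈ C ∩ D, u ∈ mintySet C D ψ g v := by
    intro v hv
    obtain ⟨x, hx, hxu⟩ := hE.exists_seq_weaklyTendsto (fun x hx => hR x hx.1.1) U (hmem v hv) hu
    exact mem_mintySet_of_weaklyTendsto hCc hC hR hψ hψc hfg hx hxu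
  have huCD := (huv v₀ hv₀).1
  refine ⟨u, huCD, fun v hv => le_of_forall_pos_le_add fun ε hε => ?_⟩
  -- Minty's trick: test with u + t (v - u), apply convexity of ψ and divide by t.
  obtain ⟨t, ht, ht0, ht1⟩ := ((hfg.ray u v ε hε).and
    (Ioo_mem_nhdsGT (zero_lt_one (α := ℝ)))).exists
  have hcomb : u + t • (v - u) = (1 - t) • u + t • v := by
    rw [smul_sub, sub_smul, one_smul]; abel
  have h1 := (huv _ (hcomb ▸ (hC.inter hψ.1) huCD hv (by linarith) ht0.le (by ring))).2
  have h2 := hψ.2 huCD.2 hv.2 (by linarith : 0 ≤ 1 - t) ht0.le (by ring)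
  rw [← hcomb, smul_eq_mul, smul_eq_mul] at h2
  have h3 : t * (f u v - ε) ≤ t * (ψ v - ψ u) := by linarith
  linarith [le_of_mul_le_mul_left h3 ht0]

end Equilibrium

/-! ### Reduction of φ to a real convex function on its domain -/

section Functional

variable {X : Type*} [NormedAddCommGroup X] [NormedSpace ℝ X] {φ : X → EReal}

theorem coe_toReal_of_mem_effDomain {S : Type*} {φ : S → EReal} (hbot : ∀ x, φ x ≠ ⊥)
    {x : S} (hx : x ∈ effDomain φ) :
    ((φ x).toReal : EReal) = φ x :=
  EReal.coe_toReal (ne_of_lt hx) (hbot x)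

theorem IsConvex.convexOn_toReal (hφ : IsConvex φ) (hbot : ∀ x, φ x ≠ ⊥) :
    ConvexOn ℝ (effDomain φ) fun x => (φ x).toReal := by
  have key : ∀ x ∈ effDomain φ, ∀ y ∈ effDomain φ, ∀ a b : ℝ, 0 ≤ a → 0 ≤ b → a + b = 1 →
      φ (a • x + b • y) ≤ ((a * (φ x).toReal + b * (φ y).toReal : ℝ) : EReal) := by
    intro x hx y hy a b ha hb hab
    have h1 := hφ x y a ha (by linarith)
    obtain rfl : b = 1 - a := by linarith
    rw [← coe_toReal_of_mem_effDomain hbot hx, ← coe_toReal_of_mem_effDomain hbot hy] at h1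
    exact_mod_cast h1
  refine ⟨fun x hx y hy a b ha hb hab => (key x hx y hy a b ha hb hab).trans_lt
    (EReal.coe_lt_top _), fun x hx y hy a b ha hb hab => ?_⟩
  exact EReal.toReal_le_toReal (key x hx y hy a b ha hb hab) (hbot _) (EReal.coe_ne_top _)

theorem isClosed_sublevel_add {X Y : Type*} [TopologicalSpace X] [TopologicalSpace Y]
    {φ : X → EReal} (hbot : ∀ x, φ x ≠ ⊥)
    (hφ : LowerSemicontinuous φ) {B : X × Y → ℝ} (hB : LowerSemicontinuous B) (a : ℝ) :
    IsClosed {w : X × Y | w ∈ effDomain φ ×ˢ (Set.univ : Set Y) ∧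
      (φ w.1).toReal + B w ≤ a} := by
  have hset : {w : X × Y | w ∈ effDomain φ ×ˢ (Set.univ : Set Y) ∧ (φ w.1).toReal + B w ≤ a} =
      {w | ((a - B w : ℝ) : EReal) < φ w.1}ᶜ := by
    ext w
    simp only [Set.mem_ofPred_eq, Set.mem_prod, Set.mem_univ, and_true, Set.mem_compl_iff, not_lt]
    constructor
    · rintro ⟨h1, h2⟩
      rw [← coe_toReal_of_mem_effDomain hbot h1, EReal.coe_le_coe_iff]
      linarith
    · intro h
      have h1 : w.1 ∈ effDomain φ := h.trans_lt (EReal.coe_lt_top _)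
      rw [← coe_toReal_of_mem_effDomain hbot h1, EReal.coe_le_coe_iff] at h
      exact ⟨h1, by linarith⟩
  rw [hset, isClosed_compl_iff, isOpen_iff_eventually]
  intro w hw
  obtain ⟨b, hb1, hb2⟩ := EReal.exists_between_coe_real hw
  rw [EReal.coe_lt_coe_iff] at hb1
  filter_upwards [hB w (a - b) (by linarith),
    (continuous_fst.tendsto w).eventually (hφ w.1 b hb2)] with z hz1 hz2
  refine lt_trans ?_ hz2
  rw [EReal.coe_lt_coe_iff]
  linarith

end Functional

end VarHemivar

/-! ### The coupled system -/

open VarHemivar in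
theorem mainTheorem2
    {X Y Z₁ Z₂ : Type*}
    [NormedAddCommGroup X] [NormedSpace ℝ X] [CompleteSpace X]
    [NormedAddCommGroup Y] [NormedSpace ℝ Y] [CompleteSpace Y]
    [NormedAddCommGroup Z₁] [NormedSpace ℝ Z₁] [CompleteSpace Z₁]
    [NormedAddCommGroup Z₂] [NormedSpace ℝ Z₂] [CompleteSpace Z₂]
    (hX : VarHemivar.IsReflexive X) (hY : VarHemivar.IsReflexive Y)
    (K : Set X) (hK_ne : K.Nonempty) (hK_bdd : Bornology.IsBounded K)
    (hK_closed : IsClosed K) (hK_conv : Convex ℝ K)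
    (Λ : Set Y) (hΛ_ne : Λ.Nonempty) (hΛ_bdd : Bornology.IsBounded Λ)
    (hΛ_closed : IsClosed Λ) (hΛ_conv : Convex ℝ Λ)
    (φ : X → EReal) (hφ_bot : ∀ x, φ x ≠ ⊥) (hφ_conv : VarHemivar.IsConvex φ)
    (hφ_lsc : LowerSemicontinuous φ) (hφK : (VarHemivar.effDomain φ ∩ K).Nonempty)
    (J : Z₁ → ℝ) (hJ : LocallyLipschitz J) (L : Z₂ → ℝ) (hL : LocallyLipschitz L)
    (γ₁ : X →L[ℝ] Z₁) (hγ₁ : IsCompactOperator γ₁)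
    (γ₂ : Y →L[ℝ] Z₂) (hγ₂ : IsCompactOperator γ₂)
    (H : Y → ℝ) (m_H : ℝ) (hH_range : ∀ σ, 0 < H σ ∧ H σ < m_H)
    (hH_cont : VarHemivar.WeaklyContinuous H)
    (B : X × Y → ℝ) (hB_conv : ConvexOn ℝ Set.univ B) (hB_lsc : LowerSemicontinuous B)
    (F : X → StrongDual ℝ X)
    (hF : VarHemivar.CondH1 F ∨ VarHemivar.CondH2 F ∨
      VarHemivar.CondH3 F (fun _ => 1) γ₁ J)
    (G : Y → StrongDual ℝ Y)
    (hG : VarHemivar.CondH1 G ∨ VarHemivar.CondH2 G ∨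
      VarHemivar.CondH3 G H γ₂ L) :
    ∃ (u : X) (σ : Y), VarHemivar.IsSolution K Λ B φ γ₁ γ₂ J L H F G u σ := by

  obtain ⟨g₁, hg₁⟩ := exists_isMintyPair hJ hγ₁ (c := fun _ => 1) continuous_const
    (fun _ => one_pos) hF
  obtain ⟨g₂, hg₂⟩ := exists_isMintyPair hL hγ₂ hH_cont (fun σ => (hH_range σ).1) hG
  have hφ' := hφ_conv.convexOn_toReal hφ_bot
  have hψ : ConvexOn ℝ (effDomain φ ×ˢ (Set.univ : Set Y)) fun w => (φ w.1).toReal + B w := by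
    refine ConvexOn.add ?_ (hB_conv.subset (Set.subset_univ _) (hφ'.1.prod convex_univ))
    exact (hφ'.comp_linearMap (LinearMap.fst ℝ X Y)).subset (fun w hw => hw.1)
      (hφ'.1.prod convex_univ)
  obtain ⟨x₀, hx₀D, hx₀K⟩ := hφK
  obtain ⟨σ₀, hσ₀⟩ := hΛ_ne
  obtain ⟨⟨u, σ⟩, ⟨⟨huK, hσ⟩, huD, -⟩, hsol⟩ := exists_equilibrium (hX.prod hY)
    (hK_closed.prod hΛ_closed) (hK_conv.prod hΛ_conv) (hK_bdd.prod hΛ_bdd) hψ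
    (isClosed_sublevel_add hφ_bot hφ_lsc hB_lsc) ⟨(x₀, σ₀), ⟨hx₀K, hσ₀⟩, hx₀D, trivial⟩
    (hg₁.prod hg₂)
    (fun w => by
      have h1 := (concaveOn_hemiForm F γ₁ hJ (c := fun _ => 1) (fun _ => one_pos)
        w.1).comp_linearMap (LinearMap.fst ℝ X Y)
      have h2 := (concaveOn_hemiForm G γ₂ hL (fun σ => (hH_range σ).1)
        w.2).comp_linearMap (LinearMap.snd ℝ X Y)
      exact h1.add h2)
    (fun w => by simp [hemiForm_self])
  refine ⟨u, σ, ⟨huK, huD⟩, hσ, fun v hv => ?_, fun μ hμ => ?_⟩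
  · have hφu := coe_toReal_of_mem_effDomain hφ_bot huD
    by_cases hvD : v ∈ effDomain φ
    · have h1 := hsol (v, σ) ⟨⟨hv, hσ⟩, hvD, trivial⟩
      simp only [hemiForm_self, add_zero] at h1
      simp only [hemiForm, one_mul] at h1
      rw [← hφu, ← coe_toReal_of_mem_effDomain hφ_bot hvD]
      norm_cast
      linarith
    -- Outside the domain of φ the right-hand side is +∞, so testing inside the domain suffices.
    · have hv_top : φ v = ⊤ := not_lt_top_iff.1 hvD
      rw [← hφu, hv_top, EReal.top_sub_coe, EReal.coe_add_top, EReal.top_add_coe]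
      exact le_top
  · have h1 := hsol (u, μ) ⟨⟨huK, hμ⟩, huD, trivial⟩
    simp only [hemiForm_self, zero_add] at h1
    simp only [hemiForm] at h1
    linarith
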